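/- Let $\kappa\in C^2([0,1]^2)$ be real-valued, let $(Kf)(x)=\int_0^1\kappa(x,y)f(y)\,dy$ on $L^2(0,1)$, with adjoint $(K^*g)(y)=\int_0^1\kappa(x,y)g(x)\,dx$, and put $$C_K:=\sup_{x,y\in[0,1]}\ \max_{n+n'\le 2}\bigl|\partial_x^n\partial_y^{n'}\kappa(x,y)\bigr| .$$ Let $(\sigma_j)_{j\ge1}$ be the singular values of $K$ (non-increasing, repeated according to multiplicity, completed by zeros if $K$ has finite rank) and $(v_j)_{j\ge1}$ associated orthonormal singular functions: $K^*Kv_j=\sigma_j^2v_j$, and $K$ vanishes on the orthogonal complement of the $v_j$. For $j$ with $\sigma_j>0$ put $\psi_-(j)=\min\{i\ge1:\sigma_i=\sigma_j\}$, $\psi_+(j)=\max\{i\ge1:\sigma_i=\sigma_j\}$ and, with $\sigma_0:=\infty$, $$c_j:=\min\bigl(\sigma_{\psi_+(j)}^2-\sigma_{\psi_+(j)+1}^2,\ \sigma_{\psi_-(j)-1}^2-\sigma_{\psi_-(j)}^2\bigr),\qquad M_j:=1+\max_{1\le i\le j}\bigl(\psi_+(i)-\psi_-(i)\bigr).$$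 Let $m\ge1$ and $\xi_l=\frac{2l-1}{2m}$, $l=1,\dots,m$, and assume that $K_m:L^2(0,1)\to\mathbb R^m$, $K_mf=m^{-1/2}\bigl((Kf)(\xi_l)\bigr)_{l=1}^m$, has full rank $m$. Let $$J_m:=\max\Bigl\{j\ge1:\ \sigma_i>0\ \text{and}\ \max\Bigl(\frac{2C_K^2}{3c_im^2},\frac{10M_iC_K^3}{c_i\sigma_im^2}\Bigr)<1\ \text{ for all }1\le i\le j\Bigr\}$$ (if there is no such $j$, nothing is claimed). Let $(\tilde z_j,\tilde w_j,\tilde\sigma_j)_{j=1}^m$ be a singular value decomposition of $A_m=\bigl(\tfrac1m\kappa(\xi_i,\xi_j)\bigr)_{i,j=1}^m$, i.e. $A_m\tilde z_j=\tilde\sigma_j\tilde w_j$, $A_m^T\tilde w_j=\tilde\sigma_j\tilde z_j$, with $(\tilde z_j)_j$ and $(\tilde w_j)_j$ orthonormal and $\tilde\sigma_1\ge\dots\ge\tilde\sigma_m\ge0$. Let $f$ belong to the closed linear span of $(v_j)_{j\ge1}$, i.e. $f=\sum_j(f,v_j)v_j$ (every $f\in L^2(0,1)$ if $K$ is injective).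 Let $\delta>0$, let $Z_1,\dots,Z_m$ be i.i.d. real random variables with $\mathbb E Z_l=0$ and $\mathbb E Z_l^2=1$, and let the data be $(g_m^\delta)_l=(Kf)(\xi_l)+\delta Z_l$. For $\tilde\sigma_1,\dots,\tilde\sigma_k>0$ the estimator is $$\tilde f^\delta_{k,m}:=\sum_{j=1}^k\frac{(g_m^\delta,\tilde w_j)_{\mathbb R^m}}{\sqrt m\,\tilde\sigma_j}\,\tilde v_j,\qquad \tilde v_j:=\frac1{\tilde\sigma_j\sqrt m}\sum_{l=1}^m(\tilde w_j)_l\,\kappa(\xi_l,\cdot).$$ Then for every $k$ with $1\le k\le J_m$ we have $k\le m$ and $\tilde\sigma_1,\dots,\tilde\sigma_k>0$ (so the estimator is well defined), the error $\tilde f_{k,m}^\delta-f$ lies in $L^2(0,1)$, its squared norm has finite expectation, and $$\begin{aligned}\sqrt{\mathbb E\|\tilde f_{k,m}^\delta-f\|^2}\ \le\ &\frac{2\delta}{\sqrt m}\sqrt{\sum_{j=1}^k\frac1{\sigma_j^2}}+\sqrt{\sum_{j=\psi_+(k)+1}^\infty(f,v_j)^2}+2M_k\sqrt{\sum_{j=\psi_-(k)}^{\psi_+(k)}(f,v_j)^2}\\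 &+\frac{(1+\sqrt{2M_k})\,C_K^3\|f\|}{m^2}\sqrt{\sum_{j=1}^k\frac1{c_j^2\sigma_j^2}}+\frac{\sqrt2\,C_K^4\|f\|}{\sqrt3\,m^3}\sum_{j=1}^k\frac1{c_j\sigma_j^2}+M_k\max_{1\le i\le\psi_+(k)}\frac{20M_iC_K^3\|f\|}{c_i\sigma_im^2}.\end{aligned}$$ -/

import Mathlib

open MeasureTheory ProbabilityTheory
open scoped RealInnerProductSpace

noncomputable section

namespace SpectralCutoff

/-- Lebesgue measure on the unit interval `(0,1)`. -/
abbrev unitMeasure : Measure ℝ := volume.restrict (Set.Ioo (0 : ℝ) 1)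

/-- The real Hilbert space `L²(0,1)`. -/
abbrev L2 : Type := Lp ℝ 2 unitMeasure

/-- The integral operator `(Kf)(x) = ∫₀¹ κ(x,y) f(y) dy`, as a pointwise defined function. -/
def opK (κ : ℝ → ℝ → ℝ) (f : ℝ → ℝ) (x : ℝ) : ℝ :=
  ∫ y, κ x y * f y ∂unitMeasure

/-- The adjoint operator `(K*g)(y) = ∫₀¹ κ(x,y) g(x) dx`. -/
def opKadj (κ : ℝ → ℝ → ℝ) (g : ℝ → ℝ) (y : ℝ) : ℝ :=
  ∫ x, κ x y * g x ∂unitMeasure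

/-- The mixed partial derivative `∂ₓⁿ ∂_yⁿ' κ (x,y)` on the closed unit square
(one-sided at the boundary). -/
def partialD (κ : ℝ → ℝ → ℝ) (n n' : ℕ) (x y : ℝ) : ℝ :=
  iteratedDerivWithin n
    (fun s => iteratedDerivWithin n' (fun t => κ s t) (Set.Icc (0 : ℝ) 1) y)
    (Set.Icc (0 : ℝ) 1) x

/-- `C_K`, the supremum over the unit square of all partial derivatives of `κ` of total order
at most two. -/
def derivBound (κ : ℝ → ℝ → ℝ) : ℝ :=
  sSup {a : ℝ | ∃ x ∈ Set.Icc (0 : ℝ) 1, ∃ y ∈ Set.Icc (0 : ℝ) 1, ∃ n n' : ℕ,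
    n + n' ≤ 2 ∧ a = |partialD κ n n' x y|}

/-- The midpoints `(2l - 1) / (2m)`, `l = 1, …, m`; the element `l` of `Fin m` stands for the
index `l + 1`. -/
def grid (m : ℕ) (l : Fin m) : ℝ := (2 * ((l : ℕ) + 1 : ℝ) - 1) / (2 * (m : ℝ))

/-- The semi-discrete operator `K_m f = m^(-1/2) ((Kf)(ξ_l))_l` from `L²(0,1)` to `ℝ^m`. -/
def semiDiscrete (κ : ℝ → ℝ → ℝ) (m : ℕ) (f : L2) : EuclideanSpace ℝ (Fin m) :=
  WithLp.toLp 2 fun l => (1 / Real.sqrt m) * opK κ f (grid m l)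

/-- The quadrature matrix `(A_m)_{ij} = κ(ξ_i, ξ_j) / m`. -/
def quadMatrix (κ : ℝ → ℝ → ℝ) (m : ℕ) : Matrix (Fin m) (Fin m) ℝ :=
  Matrix.of fun i j => (1 / (m : ℝ)) * κ (grid m i) (grid m j)

/-- `(σ_j, v_j)`, `j = 1, 2, …` (the entries with index `0` play no role), is a system of
singular values, in non-increasing order and repeated according to multiplicity, and of
singular functions of the operator `K` on `L²(0,1)`: the `v_j` are orthonormal,
`K*K v_j = σ_j² v_j`, and `K` vanishes on the orthogonal complement of all the `v_j`, so that no
nonzero singular value is omitted. If `K` has finite rank, all but finitely many `σ_j` are `0`. -/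
structure IsSingularSystem (κ : ℝ → ℝ → ℝ) (σ : ℕ → ℝ) (v : ℕ → L2) : Prop where
  nonneg : ∀ j, 1 ≤ j → 0 ≤ σ j
  antitone : ∀ i j, 1 ≤ i → i ≤ j → σ j ≤ σ i
  orthonormal : Orthonormal ℝ (fun j : ℕ => v (j + 1))
  eigen : ∀ j, 1 ≤ j → opKadj κ (opK κ (v j)) =ᵐ[unitMeasure] fun y => σ j ^ 2 * v j y
  complete : ∀ h : L2, (∀ j, 1 ≤ j → ⟪v j, h⟫ = 0) → opK κ h =ᵐ[unitMeasure] 0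

/-- `(z_j, w_j, s_j)`, `j = 1, …, m` (entries with other indices play no role), is a singular
value decomposition of the square matrix `A`: `A z_j = s_j w_j`, `Aᵀ w_j = s_j z_j`. -/
structure IsMatrixSVD {m : ℕ} (A : Matrix (Fin m) (Fin m) ℝ)
    (z w : ℕ → EuclideanSpace ℝ (Fin m)) (s : ℕ → ℝ) : Prop where
  nonneg : ∀ j, 1 ≤ j → j ≤ m → 0 ≤ s j
  antitone : ∀ i j, 1 ≤ i → i ≤ j → j ≤ m → s j ≤ s i
  orthonormal_right : Orthonormal ℝ (fun j : Fin m => z ((j : ℕ) + 1))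
  orthonormal_left : Orthonormal ℝ (fun j : Fin m => w ((j : ℕ) + 1))
  mul_right : ∀ j, 1 ≤ j → j ≤ m → ∀ i, (A.mulVec fun l => z j l) i = s j * w j i
  mul_left : ∀ j, 1 ≤ j → j ≤ m → ∀ i, (A.transpose.mulVec fun l => w j l) i = s j * z j i

/-- `ψ₋(j)`, the smallest index `i ≥ 1` with `σ_i = σ_j`. -/
def psiMinus (σ : ℕ → ℝ) (j : ℕ) : ℕ := sInf {i : ℕ | 1 ≤ i ∧ σ i = σ j}

/-- `ψ₊(j)`, the largest index `i ≥ 1` with `σ_i = σ_j` (only used where `σ_j > 0`). -/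
def psiPlus (σ : ℕ → ℝ) (j : ℕ) : ℕ := sSup {i : ℕ | 1 ≤ i ∧ σ i = σ j}

/-- The spectral gap `c_j = min (σ_{ψ₊(j)}² - σ_{ψ₊(j)+1}², σ_{ψ₋(j)-1}² - σ_{ψ₋(j)}²)` with the
convention `σ_0 = ∞`. -/
def gap (σ : ℕ → ℝ) (j : ℕ) : ℝ :=
  if psiMinus σ j = 1 then σ (psiPlus σ j) ^ 2 - σ (psiPlus σ j + 1) ^ 2
  else min (σ (psiPlus σ j) ^ 2 - σ (psiPlus σ j + 1) ^ 2)
    (σ (psiMinus σ j - 1) ^ 2 - σ (psiMinus σ j) ^ 2)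

/-- `M_i = 1 + max_{1 ≤ j ≤ i} (ψ₊(j) - ψ₋(j))`, the maximal multiplicity up to index `i`. -/
def maxMult (σ : ℕ → ℝ) (i : ℕ) : ℕ :=
  1 + (Finset.Icc 1 i).sup fun j => psiPlus σ j - psiMinus σ j

/-- The condition on a single index `i` in the definition of `J_m`. An index with `σ_i = 0`
never qualifies (the quotient is then read as `∞`). -/
def Admissible (C : ℝ) (σ : ℕ → ℝ) (m i : ℕ) : Prop :=
  0 < σ i ∧
    max (2 * C ^ 2 / (3 * gap σ i * (m : ℝ) ^ 2))
      (10 * (maxMult σ i : ℝ) * C ^ 3 / (gap σ i * σ i * (m : ℝ) ^ 2)) < 1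

/-- `J_m`, the largest `j ≥ 1` such that every `i` with `1 ≤ i ≤ j` is admissible. If there is no
such `j`, the value is `0`. -/
def maxLevel (C : ℝ) (σ : ℕ → ℝ) (m : ℕ) : ℕ :=
  sSup {j : ℕ | 1 ≤ j ∧ ∀ i, 1 ≤ i → i ≤ j → Admissible C σ m i}

/-- The noisy point evaluations `(g_m^δ)_l = (Kf)(ξ_l) + δ Z_l`, for one realisation `Z` of the
noise. -/
def noisyData (κ : ℝ → ℝ → ℝ) (m : ℕ) (f : L2) (δ : ℝ) (Z : Fin m → ℝ) :
    EuclideanSpace ℝ (Fin m) :=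
  WithLp.toLp 2 fun l => opK κ f (grid m l) + δ * Z l

/-- The approximate singular function
`ṽ_j(y) = (s_j √m)⁻¹ ∑_l (w_j)_l κ(ξ_l, y)`. -/
def approxSingFun (κ : ℝ → ℝ → ℝ) {m : ℕ} (w : ℕ → EuclideanSpace ℝ (Fin m)) (s : ℕ → ℝ)
    (j : ℕ) (y : ℝ) : ℝ :=
  1 / (s j * Real.sqrt m) * ∑ l : Fin m, w j l * κ (grid m l) y

/-- The spectral cut-off estimator `∑_{j=1}^k (g, w_j) / (√m s_j) ṽ_j` for data `g`. -/
def estimator (κ : ℝ → ℝ → ℝ) {m : ℕ} (w : ℕ → EuclideanSpace ℝ (Fin m)) (s : ℕ → ℝ)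
    (g : EuclideanSpace ℝ (Fin m)) (k : ℕ) (y : ℝ) : ℝ :=
  ∑ j ∈ Finset.Icc 1 k, ⟪g, w j⟫ / (Real.sqrt m * s j) * approxSingFun κ w s j y

/-- The squared `L²(0,1)`-norm of a (square integrable) function. -/
def normSq (h : ℝ → ℝ) : ℝ := ∫ y, h y ^ 2 ∂unitMeasure

end SpectralCutoff

end

open SpectralCutoff

/-! Put η = C_K²/m², L = K_m and B = A_m A_mᵀ, with eigenpairs (σ̃_j², w̃_j). Two applications of
the midpoint rule, one to the product (Kx)(Ky) and one to (L*u)(L*u'), show that K*K differs from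
L*L and LL* from B by at most η in operator norm. Everything else is Hilbert space perturbation
theory for such a pair of approximations (`IsDiscretization`).

With S the inverse of B truncated to its k leading eigenvectors, the estimator is L*S applied to the
rescaled data, so its error is the bias (L*SL - I)f plus a noise term with uncorrelated
coefficients. A min-max argument gives |σ_j² - σ̃_j²| ≤ 2η, and admissibility gives 10η ≤ c_j ≤
σ_j². Hence σ̃_j² is comparable to σ_j² for j ≤ k, which yields k ≤ m, positivity of σ̃_j, and the
variance bound with factor 2 (`IsDiscretization.sum_norm_sq_noise_le`).

For the bias, L*SL - I has norm at most one (`IsDiscretization.norm_cutoff_sub_le`). This is enough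
for the tail of f and for the block of indices with σ_j = σ_k, where no gap separates the spectrum
from the cut-off. On the leading singular functions, below ψ₋(k), the gap c_k makes L*SL - I of size
6ηC_K/(c_kσ_k) (`IsDiscretization.norm_cutoff_sub_leading_le`). The essential estimate there is of
Davis–Kahan type: discretization moves little of the leading singular space beyond the truncation
level (`IsDiscretization.norm_tail_comp_le`).

No individual singular vector is compared with its approximation. The bound obtained is therefore
stronger than the one claimed, whose fourth and fifth terms enter only as nonnegative quantities. -/

namespace SpectralCutoff

/-! ### Diagonal operators in an orthonormal family -/

section Diagonal

variable {H : Type*} [NormedAddCommGroup H] [InnerProductSpace ℝ H] {ι : Type*}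

/-- The diagonal operator `x ↦ ∑ i ∈ t, a i ⟪e i, x⟫ e i`. -/
noncomputable def diagOp (t : Finset ι) (e : ι → H) (a : ι → ℝ) : H →L[ℝ] H :=
  ∑ i ∈ t, a i • (innerSL ℝ (e i)).smulRight (e i)

lemma diagOp_apply (t : Finset ι) (e : ι → H) (a : ι → ℝ) (x : H) :
    diagOp t e a x = ∑ i ∈ t, (a i * ⟪e i, x⟫) • e i := by
  simp [diagOp, smul_smul]

lemma inner_diagOp (t : Finset ι) (e : ι → H) (a : ι → ℝ) (x y : H) :
    ⟪diagOp t e a x, y⟫ = ∑ i ∈ t, a i * ⟪e i, x⟫ * ⟪e i, y⟫ := by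
  simp [diagOp_apply, sum_inner, inner_smul_left]

lemma inner_basis_diagOp [DecidableEq ι] {e : ι → H} (he : Orthonormal ℝ e) (t : Finset ι)
    (a : ι → ℝ) (x : H) (i : ι) :
    ⟪e i, diagOp t e a x⟫ = if i ∈ t then a i * ⟪e i, x⟫ else 0 := by
  rw [real_inner_comm, inner_diagOp t e a x (e i)]
  have h : ∀ j, ⟪e j, e i⟫ = if j = i then (1 : ℝ) else 0 := by
    intro j
    exact orthonormal_iff_ite.1 he j i
  simp [h]

lemma diagOp_diagOp {e : ι → H} (he : Orthonormal ℝ e) (t : Finset ι) (a b : ι → ℝ) (x : H) :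
    diagOp t e a (diagOp t e b x) = diagOp t e (fun i => a i * b i) x := by
  classical
  rw [diagOp_apply t e a, diagOp_apply t e fun i => a i * b i]
  refine Finset.sum_congr rfl fun i hi => ?_
  rw [inner_basis_diagOp he, if_pos hi, mul_assoc]

lemma norm_sq_diagOp {e : ι → H} (he : Orthonormal ℝ e) (t : Finset ι) (a : ι → ℝ) (x : H) :
    ‖diagOp t e a x‖ ^ 2 = ∑ i ∈ t, a i ^ 2 * ⟪e i, x⟫ ^ 2 := by
  classical
  rw [← real_inner_self_eq_norm_sq, inner_diagOp]
  refine Finset.sum_congr rfl fun i hi => ?_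
  rw [inner_basis_diagOp he, if_pos hi]
  ring

lemma sum_sq_inner_le {e : ι → H} (he : Orthonormal ℝ e) (t : Finset ι) (x : H) :
    ∑ i ∈ t, ⟪e i, x⟫ ^ 2 ≤ ‖x‖ ^ 2 := by
  simpa using he.sum_inner_products_le x (s := t)

lemma norm_diagOp_le {e : ι → H} (he : Orthonormal ℝ e) (t : Finset ι) (a : ι → ℝ) {c : ℝ}
    (hc : 0 ≤ c) (ha : ∀ i ∈ t, |a i| ≤ c) (x : H) : ‖diagOp t e a x‖ ≤ c * ‖x‖ := by
  refine abs_le_of_sq_le_sq' ?_ (by positivity) |>.2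
  rw [norm_sq_diagOp he, mul_pow]
  calc ∑ i ∈ t, a i ^ 2 * ⟪e i, x⟫ ^ 2 ≤ ∑ i ∈ t, c ^ 2 * ⟪e i, x⟫ ^ 2 := by
        refine Finset.sum_le_sum fun i hi => ?_
        exact mul_le_mul_of_nonneg_right
          (sq_le_sq' (abs_le.1 (ha i hi)).1 (abs_le.1 (ha i hi)).2) (sq_nonneg _)
    _ ≤ c ^ 2 * ‖x‖ ^ 2 := by
        rw [← Finset.mul_sum]
        gcongr
        exact sum_sq_inner_le he t x

/-- Testing against `a` itself suffices. This turns the bilinear form estimates of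
`IsDiscretization` into norm estimates for operators. -/
lemma norm_le_of_forall_inner_le {a : H} {c : ℝ} (hc : 0 ≤ c)
    (h : ∀ y, |⟪a, y⟫| ≤ c * ‖y‖) : ‖a‖ ≤ c := by
  rcases eq_or_ne a 0 with rfl | ha
  · simpa using hc
  · have := h a
    rw [real_inner_self_eq_norm_sq, abs_of_nonneg (by positivity), sq] at this
    exact le_of_mul_le_mul_right this (norm_pos_iff.2 ha)

/-- Splitting a vector along an orthonormal sequence. -/
lemma exists_hasSum_inner_smul [CompleteSpace H] {e : ι → H} (he : Orthonormal ℝ e) (x : H) :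
    ∃ p : H, HasSum (fun i => ⟪e i, x⟫ • e i) p ∧ ∀ i, ⟪e i, x - p⟫ = 0 := by
  classical
  have hs : Summable fun i => ⟪e i, x⟫ • e i := by
    have h1 := he.orthogonalFamily.summable_iff_norm_sq_summable (fun i => ⟪e i, x⟫)
    simp only [LinearIsometry.toSpanSingleton_apply] at h1
    rw [h1]
    exact he.inner_products_summable x
  refine ⟨_, hs.hasSum, fun i => ?_⟩
  have h2 : HasSum (fun j => ⟪e i, ⟪e j, x⟫ • e j⟫) ⟪e i, ∑' j, ⟪e j, x⟫ • e j⟫ :=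
    (innerSL ℝ (e i)).hasSum hs.hasSum
  have h3 : HasSum (fun j => ⟪e i, ⟪e j, x⟫ • e j⟫) ⟪e i, x⟫ := by
    have := hasSum_ite_eq i (⟪e i, x⟫)
    convert this using 2 with j
    rw [inner_smul_right, orthonormal_iff_ite.1 he i j]
    split_ifs with h1 h2 h2
    · rw [h1]; simp
    · exact absurd h1.symm h2
    · exact absurd h2.symm h1
    · simp
  rw [inner_sub_right, h2.unique h3, sub_self]

end Diagonal


/-! ### Abstract discretizations: the two approximation hypotheses and their quadratic forms -/

/-- A compact operator `K` with singular functions `e` and squared singular values `lam`, together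
with a semidiscretization `L` such that `L L†` is close to a matrix with eigenbasis `w` and
eigenvalues `mu`. -/
structure IsDiscretization {H H' E : Type*} [NormedAddCommGroup H] [InnerProductSpace ℝ H]
    [CompleteSpace H] [NormedAddCommGroup H'] [InnerProductSpace ℝ H'] [NormedAddCommGroup E]
    [InnerProductSpace ℝ E] [CompleteSpace E] {m : ℕ}
    (K : H →L[ℝ] H') (L : H →L[ℝ] E) (e : ℕ → H) (lam : ℕ → ℝ)
    (w : OrthonormalBasis (Fin m) ℝ E) (mu : Fin m → ℝ) (η : ℝ) : Prop where
  lam_antitone : Antitone lam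
  mu_antitone : Antitone mu
  mu_nonneg : ∀ j, 0 ≤ mu j
  eta_nonneg : 0 ≤ η
  orthonormal : Orthonormal ℝ e
  eigen : ∀ j y, ⟪K (e j), K y⟫ = lam j * ⟪e j, y⟫
  complete : ∀ h, (∀ j, ⟪e j, h⟫ = 0) → K h = 0
  form_close : ∀ x y, |⟪K x, K y⟫ - ⟪L x, L y⟫| ≤ η * ‖x‖ * ‖y‖
  adjoint_close : ∀ u u', |⟪L.adjoint u, L.adjoint u'⟫ - ∑ j, mu j * ⟪w j, u⟫ * ⟪w j, u'⟫| ≤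
    η * ‖u‖ * ‖u'‖

namespace IsDiscretization

variable {H H' E : Type*} [NormedAddCommGroup H] [InnerProductSpace ℝ H]
    [CompleteSpace H] [NormedAddCommGroup H'] [InnerProductSpace ℝ H'] [NormedAddCommGroup E]
    [InnerProductSpace ℝ E] [CompleteSpace E] {m : ℕ}
    {K : H →L[ℝ] H'} {L : H →L[ℝ] E} {e : ℕ → H} {lam : ℕ → ℝ}
    {w : OrthonormalBasis (Fin m) ℝ E} {mu : Fin m → ℝ} {η : ℝ}

lemma norm_sq_eigen (h : IsDiscretization K L e lam w mu η) (j : ℕ) :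
    ‖K (e j)‖ ^ 2 = lam j := by
  rw [← real_inner_self_eq_norm_sq, h.eigen, real_inner_self_eq_norm_sq, h.orthonormal.1 j]
  simp

lemma lam_nonneg (h : IsDiscretization K L e lam w mu η) (j : ℕ) : 0 ≤ lam j :=
  h.norm_sq_eigen j ▸ sq_nonneg _

/-- Upper half of the min-max principle. `complete` removes the component of `g` outside the closed
span of the `e i`, so `‖K g‖ ^ 2` expands as the sum of `lam i * ⟪e i, g⟫ ^ 2`; Bessel's inequality
finishes. -/
lemma norm_sq_le_of_orthogonal (h : IsDiscretization K L e lam w mu η) (n : ℕ) (g : H)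
    (hg : ∀ i < n, ⟪e i, g⟫ = 0) : ‖K g‖ ^ 2 ≤ lam n * ‖g‖ ^ 2 := by
  obtain ⟨p, hp, hpg⟩ := exists_hasSum_inner_smul h.orthonormal g
  have hKp : K g = K p := by
    have := h.complete _ hpg
    rwa [map_sub, sub_eq_zero] at this
  have h1 : HasSum (fun i => lam i * ⟪e i, g⟫ ^ 2) (‖K g‖ ^ 2) := by
    have := ((innerSL ℝ (K g)).comp K).hasSum hp
    have hp' : ((innerSL ℝ (K g)).comp K) p = ‖K g‖ ^ 2 := by
      simp only [ContinuousLinearMap.comp_apply, innerSL_apply_apply]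
      rw [← hKp, real_inner_self_eq_norm_sq]
    rw [hp'] at this
    have hterm : (fun i => lam i * ⟪e i, g⟫ ^ 2) = fun i => ⟪K g, K (⟪e i, g⟫ • e i)⟫ := by
      funext i
      rw [map_smul, inner_smul_right, real_inner_comm (K (e i)), h.eigen]
      ring
    rw [hterm]
    exact this
  have hs : Summable fun i => ⟪e i, g⟫ ^ 2 := by
    simpa using h.orthonormal.inner_products_summable g
  have h2 : HasSum (fun i => lam n * ⟪e i, g⟫ ^ 2) (lam n * ∑' i, ⟪e i, g⟫ ^ 2) :=
    hs.hasSum.mul_left _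
  refine (hasSum_le (fun i => ?_) h1 h2).trans ?_
  · rcases lt_or_ge i n with hi | hi
    · simp [hg i hi]
    · exact mul_le_mul_of_nonneg_right (h.lam_antitone hi) (sq_nonneg _)
  · refine mul_le_mul_of_nonneg_left ?_ (h.lam_nonneg n)
    simpa using h.orthonormal.tsum_inner_products_le g

lemma map_form_diagOp (h : IsDiscretization K L e lam w mu η) (t : Finset ℕ) (a : ℕ → ℝ)
    (x y : H) : ⟪K (diagOp t e a x), K y⟫ = ⟪diagOp t e (fun i => lam i * a i) x, y⟫ := by
  rw [inner_diagOp, diagOp_apply, map_sum, sum_inner]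
  refine Finset.sum_congr rfl fun i _ => ?_
  rw [map_smul, real_inner_smul_left, h.eigen]
  ring

/-- The error of the semidiscretization, as an operator. -/
lemma norm_map_sub_le (h : IsDiscretization K L e lam w mu η) {x z : H}
    (hz : ∀ y, ⟪K x, K y⟫ = ⟪z, y⟫) : ‖z - L.adjoint (L x)‖ ≤ η * ‖x‖ := by
  refine norm_le_of_forall_inner_le (mul_nonneg h.eta_nonneg (norm_nonneg _)) fun y => ?_
  rw [inner_sub_left, ← hz, ContinuousLinearMap.adjoint_inner_left]
  exact h.form_close x y

/-- Operator form of `adjoint_close`: `L L†` is within `η` of the operator B with eigenpairs `(mu j,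
w j)`. -/
lemma norm_adjoint_sub_le (h : IsDiscretization K L e lam w mu η) (u : E) :
    ‖L (L.adjoint u) - diagOp Finset.univ w mu u‖ ≤ η * ‖u‖ := by
  refine norm_le_of_forall_inner_le (mul_nonneg h.eta_nonneg (norm_nonneg _)) fun y => ?_
  rw [inner_sub_left, inner_diagOp, ← ContinuousLinearMap.adjoint_inner_right]
  exact h.adjoint_close u y

lemma norm_sq_adjoint_le (h : IsDiscretization K L e lam w mu η) (u : E) :
    ‖L.adjoint u‖ ^ 2 ≤ ∑ j, mu j * ⟪w j, u⟫ ^ 2 + η * ‖u‖ ^ 2 := by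
  have := (abs_le.1 (h.adjoint_close u u)).2
  rw [real_inner_self_eq_norm_sq] at this
  have h2 : ∑ j, mu j * ⟪w j, u⟫ ^ 2 = ∑ j, mu j * ⟪w j, u⟫ * ⟪w j, u⟫ :=
    Finset.sum_congr rfl fun j _ => by ring
  rw [h2]
  linarith

lemma le_norm_sq_adjoint (h : IsDiscretization K L e lam w mu η) (u : E) :
    ∑ j, mu j * ⟪w j, u⟫ ^ 2 ≤ ‖L.adjoint u‖ ^ 2 + η * ‖u‖ ^ 2 := by
  have := (abs_le.1 (h.adjoint_close u u)).1
  rw [real_inner_self_eq_norm_sq] at this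
  have h2 : ∑ j, mu j * ⟪w j, u⟫ ^ 2 = ∑ j, mu j * ⟪w j, u⟫ * ⟪w j, u⟫ :=
    Finset.sum_congr rfl fun j _ => by ring
  rw [h2]
  linarith

lemma norm_sq_map_le (h : IsDiscretization K L e lam w mu η) (x : H) :
    ‖L x‖ ^ 2 ≤ ‖K x‖ ^ 2 + η * ‖x‖ ^ 2 := by
  have := (abs_le.1 (h.form_close x x)).1
  rw [real_inner_self_eq_norm_sq, real_inner_self_eq_norm_sq] at this
  linarith

lemma le_norm_sq_map (h : IsDiscretization K L e lam w mu η) (x : H) :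
    ‖K x‖ ^ 2 ≤ ‖L x‖ ^ 2 + η * ‖x‖ ^ 2 := by
  have := (abs_le.1 (h.form_close x x)).2
  rw [real_inner_self_eq_norm_sq, real_inner_self_eq_norm_sq] at this
  linarith

end IsDiscretization

/-! ### Min-max comparison of the exact and the discrete eigenvalues -/

/-- Homogeneous linear systems with more unknowns than equations, solved in the span of an
orthonormal family. -/
lemma exists_combination_ne_zero {V : Type*} [NormedAddCommGroup V] [InnerProductSpace ℝ V]
    {n r : ℕ} (hnr : n < r) {b : Fin r → V} (hb : Orthonormal ℝ b) (φ : Fin n → V →ₗ[ℝ] ℝ) :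
    ∃ c : Fin r → ℝ, ∑ i, c i • b i ≠ 0 ∧ ∀ l, φ l (∑ i, c i • b i) = 0 := by
  let S : (Fin r → ℝ) →ₗ[ℝ] V := Fintype.linearCombination ℝ b
  let Φ : (Fin r → ℝ) →ₗ[ℝ] (Fin n → ℝ) := (LinearMap.pi φ).comp S
  have hker : LinearMap.ker Φ ≠ ⊥ := LinearMap.ker_ne_bot_of_finrank_lt (by simpa using hnr)
  obtain ⟨c, hc, hc0⟩ := (Submodule.ne_bot_iff _).1 hker
  refine ⟨c, fun h0 => hc0 ?_, fun l => ?_⟩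
  · funext i
    exact Fintype.linearIndependent_iff.1 hb.linearIndependent c h0 i
  · have := congrFun (LinearMap.mem_ker.1 hc) l
    simpa [Φ, S, Fintype.linearCombination_apply] using this

namespace IsDiscretization

variable {H H' E : Type*} [NormedAddCommGroup H] [InnerProductSpace ℝ H]
    [CompleteSpace H] [NormedAddCommGroup H'] [InnerProductSpace ℝ H'] [NormedAddCommGroup E]
    [InnerProductSpace ℝ E] [CompleteSpace E] {m : ℕ}
    {K : H →L[ℝ] H'} {L : H →L[ℝ] E} {e : ℕ → H} {lam : ℕ → ℝ}
    {w : OrthonormalBasis (Fin m) ℝ E} {mu : Fin m → ℝ} {η : ℝ}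

/-- Courant–Fischer through the intermediate operators `L L†` and `L† L`, which share their nonzero
spectrum. Some nonzero `u` in the span of the first `n + 1` vectors `w` has `L† u` orthogonal to the
first `n` vectors `e`. One `η` is lost in passing from B to `L L†`, the other from `L† L` to `K† K`.
-/
lemma mu_le (h : IsDiscretization K L e lam w mu η) (n : Fin m) :
    mu n ≤ lam n + 2 * η := by
  let b : Fin (n + 1) → E := fun i => w ⟨i, lt_of_lt_of_le i.2 n.2⟩
  have hinj : Function.Injective (fun i : Fin (n + 1) => (⟨i, lt_of_lt_of_le i.2 n.2⟩ : Fin m)) :=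
    fun i j hij => by simpa [Fin.ext_iff] using hij
  have hb : Orthonormal ℝ b := w.orthonormal.comp _ hinj
  obtain ⟨c, hc0, hc⟩ := exists_combination_ne_zero (Nat.lt_succ_self n) hb
    (fun l : Fin n => ((innerSL ℝ (e l)).comp L.adjoint : E →ₗ[ℝ] ℝ))
  set u := ∑ i, c i • b i with hu
  have hg : ∀ i < (n : ℕ), ⟪e i, L.adjoint u⟫ = 0 := fun i hi => by simpa using hc ⟨i, hi⟩
  have hu0 : 0 < ‖u‖ := norm_pos_iff.2 hc0
  have hlow : mu n * ‖u‖ ^ 2 ≤ ∑ j, mu j * ⟪w j, u⟫ ^ 2 := by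
    have hsum : ‖u‖ ^ 2 = ∑ j, ⟪w j, u⟫ ^ 2 := by
      rw [← w.sum_sq_norm_inner_right u]; simp
    rw [hsum, Finset.mul_sum]
    refine Finset.sum_le_sum fun j _ => ?_
    rcases le_or_gt j n with hj | hj
    · exact mul_le_mul_of_nonneg_right (h.mu_antitone hj) (sq_nonneg _)
    · have : ⟪w j, u⟫ = 0 := by
        rw [hu, inner_sum]
        refine Finset.sum_eq_zero fun i _ => ?_
        rw [inner_smul_right, w.orthonormal.2, mul_zero]
        rintro rfl
        exact absurd i.2 (by simpa [Fin.lt_def] using hj)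
      simp [this]
  set g := L.adjoint u with hgdef
  have h1 : mu n * ‖u‖ ^ 2 ≤ ‖g‖ ^ 2 + η * ‖u‖ ^ 2 := hlow.trans (h.le_norm_sq_adjoint u)
  have h2 : ‖L g‖ ^ 2 ≤ (lam n + η) * ‖g‖ ^ 2 := by
    have := h.norm_sq_map_le g
    have := h.norm_sq_le_of_orthogonal n g hg
    linarith
  -- As `‖g‖ ^ 2 = ⟪L g, u⟫`, a bound on `L` at `g = L† u` becomes a bound on `L†` at `u`; this
  -- transfers the spectral estimate from `L† L` to `L L†`.
  have h3 : ‖g‖ ^ 2 ≤ ‖L g‖ * ‖u‖ := by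
    rw [← real_inner_self_eq_norm_sq]
    nth_rewrite 2 [hgdef]
    rw [ContinuousLinearMap.adjoint_inner_right]
    exact real_inner_le_norm _ _
  have h4 : ‖g‖ ^ 2 ≤ (lam n + η) * ‖u‖ ^ 2 := by
    have h5 : (‖g‖ ^ 2) ^ 2 ≤ ((lam n + η) * ‖u‖ ^ 2) * ‖g‖ ^ 2 :=
      calc (‖g‖ ^ 2) ^ 2 ≤ (‖L g‖ * ‖u‖) ^ 2 := by gcongr
        _ = ‖L g‖ ^ 2 * ‖u‖ ^ 2 := by ring
        _ ≤ ((lam n + η) * ‖g‖ ^ 2) * ‖u‖ ^ 2 := by gcongr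
        _ = _ := by ring
    rcases eq_or_lt_of_le (sq_nonneg ‖g‖) with hz | hz
    · rw [← hz]
      exact mul_nonneg (add_nonneg (h.lam_nonneg _) h.eta_nonneg) (sq_nonneg _)
    · rw [sq (‖g‖ ^ 2)] at h5
      exact le_of_mul_le_mul_right h5 hz
  have h6 : mu n * ‖u‖ ^ 2 ≤ (lam n + 2 * η) * ‖u‖ ^ 2 := by linarith
  exact le_of_mul_le_mul_right h6 (by positivity)

/-- Lower half of the min-max principle, on the span of the first `r + 1` singular functions. -/
lemma lam_mul_norm_sq_le (h : IsDiscretization K L e lam w mu η) {r : ℕ}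
    (c : Fin (r + 1) → ℝ) :
    lam r * ‖∑ i, c i • e i‖ ^ 2 ≤ ‖K (∑ i, c i • e i)‖ ^ 2 := by
  have hb : Orthonormal ℝ (fun i : Fin (r + 1) => e i) := h.orthonormal.comp _ Fin.val_injective
  have h1 : ‖∑ i, c i • e i‖ ^ 2 = ∑ i, c i ^ 2 := by
    rw [← real_inner_self_eq_norm_sq, hb.inner_sum]
    simp [sq]
  have h2 : ‖K (∑ i, c i • e i)‖ ^ 2 = ∑ i : Fin (r + 1), lam i * c i ^ 2 := by
    rw [← real_inner_self_eq_norm_sq]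
    nth_rewrite 1 [map_sum]
    rw [sum_inner]
    refine Finset.sum_congr rfl fun i _ => ?_
    rw [map_smul, real_inner_smul_left, h.eigen, hb.inner_right_fintype]
    ring
  rw [h1, h2, Finset.mul_sum]
  exact Finset.sum_le_sum fun i _ => mul_le_mul_of_nonneg_right
    (h.lam_antitone (Nat.lt_succ_iff.1 i.2)) (sq_nonneg _)

/-- The argument of `mu_le` with the two sides exchanged: the test vector lies in the span of the
leading `e i` and its image under `L` is orthogonal to the leading `w i`. -/
lemma lam_le (h : IsDiscretization K L e lam w mu η) (n : Fin m) :
    lam n ≤ mu n + 2 * η := by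
  have hb : Orthonormal ℝ (fun i : Fin ((n : ℕ) + 1) => e i) :=
    h.orthonormal.comp _ Fin.val_injective
  obtain ⟨c, hc0, hc⟩ := exists_combination_ne_zero (Nat.lt_succ_self n) hb
    (fun l : Fin n => ((innerSL ℝ (w ⟨l, l.2.trans n.2⟩)).comp L : H →ₗ[ℝ] ℝ))
  have hlow := h.lam_mul_norm_sq_le c
  set x := ∑ i, c i • e i with hx
  have hx0 : 0 < ‖x‖ := norm_pos_iff.2 hc0
  have hg : ∀ i < n, ⟪w i, L x⟫ = 0 := fun i hi => by simpa using hc ⟨i, hi⟩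
  set g := L x with hgdef
  have h1 : lam n * ‖x‖ ^ 2 ≤ ‖g‖ ^ 2 + η * ‖x‖ ^ 2 := hlow.trans (h.le_norm_sq_map x)
  have h2 : ‖L.adjoint g‖ ^ 2 ≤ (mu n + η) * ‖g‖ ^ 2 := by
    have h3 := h.norm_sq_adjoint_le g
    have hsum : ‖g‖ ^ 2 = ∑ j, ⟪w j, g⟫ ^ 2 := by
      rw [← w.sum_sq_norm_inner_right g]; simp
    have h4 : ∑ j, mu j * ⟪w j, g⟫ ^ 2 ≤ mu n * ‖g‖ ^ 2 := by
      rw [hsum, Finset.mul_sum]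
      refine Finset.sum_le_sum fun j _ => ?_
      rcases lt_or_ge j n with hj | hj
      · simp [hg j hj]
      · exact mul_le_mul_of_nonneg_right (h.mu_antitone hj) (sq_nonneg _)
    linarith
  have h3 : ‖g‖ ^ 2 ≤ ‖L.adjoint g‖ * ‖x‖ := by
    rw [← real_inner_self_eq_norm_sq]
    nth_rewrite 2 [hgdef]
    rw [← ContinuousLinearMap.adjoint_inner_left]
    exact real_inner_le_norm _ _
  have h4 : ‖g‖ ^ 2 ≤ (mu n + η) * ‖x‖ ^ 2 := by
    have h5 : (‖g‖ ^ 2) ^ 2 ≤ ((mu n + η) * ‖x‖ ^ 2) * ‖g‖ ^ 2 :=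
      calc (‖g‖ ^ 2) ^ 2 ≤ (‖L.adjoint g‖ * ‖x‖) ^ 2 := by gcongr
        _ = ‖L.adjoint g‖ ^ 2 * ‖x‖ ^ 2 := by ring
        _ ≤ ((mu n + η) * ‖g‖ ^ 2) * ‖x‖ ^ 2 := by gcongr
        _ = _ := by ring
    rcases eq_or_lt_of_le (sq_nonneg ‖g‖) with hz | hz
    · rw [← hz]
      exact mul_nonneg (add_nonneg (h.mu_nonneg _) h.eta_nonneg) (sq_nonneg _)
    · rw [sq (‖g‖ ^ 2)] at h5
      exact le_of_mul_le_mul_right h5 hz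
  have h6 : lam n * ‖x‖ ^ 2 ≤ (mu n + 2 * η) * ‖x‖ ^ 2 := by linarith
  exact le_of_mul_le_mul_right h6 (by positivity)

/-- Since `E` has dimension `m`, `L` kills a nonzero combination of any `m + 1` of the `e i`, and
there the form of `K` is at most `η`. This is what forces the cut-off index to be at most `m`. -/
lemma lam_le_of_le (h : IsDiscretization K L e lam w mu η) {n : ℕ} (hn : m ≤ n) :
    lam n ≤ η := by
  have hb : Orthonormal ℝ (fun i : Fin (n + 1) => e i) :=
    h.orthonormal.comp _ Fin.val_injective
  obtain ⟨c, hc0, hc⟩ := exists_combination_ne_zero (Nat.lt_succ_of_le hn) hb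
    (fun l : Fin m => ((innerSL ℝ (w l)).comp L : H →ₗ[ℝ] ℝ))
  have hlow := h.lam_mul_norm_sq_le c
  set x := ∑ i, c i • e i with hx
  have hx0 : 0 < ‖x‖ := norm_pos_iff.2 hc0
  have hg : L x = 0 := by
    have hsum := w.sum_sq_norm_inner_right (L x)
    have : ∀ i, ⟪w i, L x⟫ = 0 := fun i => by simpa using hc i
    simpa [this] using hsum.symm
  have h1 := h.le_norm_sq_map x
  rw [hg, norm_zero] at h1
  exact le_of_mul_le_mul_right (by linarith : lam n * ‖x‖ ^ 2 ≤ η * ‖x‖ ^ 2) (by positivity)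

end IsDiscretization
-- Spectral cut-off: stability and bias
lemma diagOp_congr {H ι : Type*} [NormedAddCommGroup H] [InnerProductSpace ℝ H] {t : Finset ι}
    {e : ι → H} {a b : ι → ℝ} (hab : ∀ i ∈ t, a i = b i) (x : H) :
    diagOp t e a x = diagOp t e b x := by
  rw [diagOp_apply, diagOp_apply]
  exact Finset.sum_congr rfl fun i hi => by rw [hab i hi]

/-- Eigenvalues of the truncated inverse. -/
noncomputable def truncInv {m : ℕ} (mu : Fin m → ℝ) (n j : Fin m) : ℝ :=
  if j ≤ n then 1 / mu j else 0

/-- The indicator of the indices above the truncation level. -/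
noncomputable def tailInd {m : ℕ} (n j : Fin m) : ℝ := if j ≤ n then 0 else 1

namespace IsDiscretization

variable {H H' E : Type*} [NormedAddCommGroup H] [InnerProductSpace ℝ H]
    [CompleteSpace H] [NormedAddCommGroup H'] [InnerProductSpace ℝ H'] [NormedAddCommGroup E]
    [InnerProductSpace ℝ E] [CompleteSpace E] {m : ℕ}
    {K : H →L[ℝ] H'} {L : H →L[ℝ] E} {e : ℕ → H} {lam : ℕ → ℝ}
    {w : OrthonormalBasis (Fin m) ℝ E} {mu : Fin m → ℝ} {η : ℝ}

/-- Every norm of `L†` composed with a function of B reduces through this bound to a scalar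
inequality for each eigenvalue. -/
lemma norm_sq_adjoint_diagOp_le (h : IsDiscretization K L e lam w mu η) (a : Fin m → ℝ)
    (u : E) : ‖L.adjoint (diagOp Finset.univ w a u)‖ ^ 2 ≤
      ∑ j, (mu j + η) * a j ^ 2 * ⟪w j, u⟫ ^ 2 := by
  refine (h.norm_sq_adjoint_le _).trans (le_of_eq ?_)
  rw [norm_sq_diagOp w.orthonormal, Finset.mul_sum, ← Finset.sum_add_distrib]
  refine Finset.sum_congr rfl fun j _ => ?_
  rw [inner_basis_diagOp w.orthonormal, if_pos (Finset.mem_univ j)]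
  ring

/-- The spectral cut-off operator differs from the identity by a contraction. -/
lemma norm_cutoff_sub_le (h : IsDiscretization K L e lam w mu η) {n : Fin m}
    (hpos : 0 < mu n) (hη : η ≤ mu n) (x : H) :
    ‖L.adjoint (diagOp Finset.univ w (truncInv mu n) (L x)) - x‖ ≤ ‖x‖ := by
  refine abs_le_of_sq_le_sq' ?_ (norm_nonneg _) |>.2
  -- Expanding the square, the cross term is `⟪S L x, L x⟫`, a diagonal sum. It remains to see that
  -- twice this sum dominates `‖L† S L x‖ ^ 2`.
  rw [norm_sub_sq_real, ContinuousLinearMap.adjoint_inner_left, inner_diagOp]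
  have h1 := h.norm_sq_adjoint_diagOp_le (truncInv mu n) (L x)
  have h2 : ∑ j, (mu j + η) * truncInv mu n j ^ 2 * ⟪w j, L x⟫ ^ 2 ≤
      2 * ∑ j, truncInv mu n j * ⟪w j, L x⟫ * ⟪w j, L x⟫ := by
    rw [Finset.mul_sum]
    refine Finset.sum_le_sum fun j _ => ?_
    -- For retained indices this reads `(mu j + η) / mu j ^ 2 ≤ 2 / mu j`, that is `η ≤ mu j`.
    have h3 : (mu j + η) * truncInv mu n j ^ 2 ≤ 2 * truncInv mu n j := by
      unfold truncInv
      split_ifs with hj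
      · have hmu := h.mu_antitone hj
        have hmu0 : 0 < mu j := hpos.trans_le hmu
        rw [div_pow, one_pow, mul_one_div, mul_one_div, div_le_div_iff₀ (by positivity) hmu0]
        nlinarith
      · simp
    nlinarith [mul_le_mul_of_nonneg_right h3 (sq_nonneg ⟪w j, L x⟫)]
  linarith

/-- The scalar factor `(mu j + η) / mu j ^ 2` decreases in `mu j`, so the worst retained index is
`n`. With `r` of order `√(mu n)` the bound is of order `1 / √(mu n)`. -/
lemma norm_adjoint_truncInv_le (h : IsDiscretization K L e lam w mu η) {n : Fin m}
    (hpos : 0 < mu n) {r : ℝ} (hr : 0 ≤ r) (hmr : mu n + η ≤ r ^ 2) (u : E) :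
    ‖L.adjoint (diagOp Finset.univ w (truncInv mu n) u)‖ ≤ r / mu n * ‖u‖ := by
  refine abs_le_of_sq_le_sq' ?_ (by positivity) |>.2
  refine (h.norm_sq_adjoint_diagOp_le _ u).trans ?_
  rw [mul_pow]
  refine le_trans ?_ (mul_le_mul_of_nonneg_left (sum_sq_inner_le w.orthonormal Finset.univ u)
    (by positivity))
  rw [Finset.mul_sum]
  refine Finset.sum_le_sum fun j _ => mul_le_mul_of_nonneg_right ?_ (sq_nonneg _)
  unfold truncInv
  split_ifs with hj
  · have hmu := h.mu_antitone hj
    have hmu0 : 0 < mu j := hpos.trans_le hmu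
    have hη := h.eta_nonneg
    calc (mu j + η) * (1 / mu j) ^ 2 = 1 / mu j + η / mu j ^ 2 := by field_simp
      _ ≤ 1 / mu n + η / mu n ^ 2 := by gcongr
      _ = (mu n + η) / mu n ^ 2 := by field_simp
      _ ≤ _ := by rw [div_pow]; gcongr
  · simp; positivity

/-- Complement of the preceding estimate: beyond index `n` the eigenvalues are at most `mu n`, so
`L†` itself is of size `√(mu n + η)` there. -/
lemma norm_adjoint_tail_le (h : IsDiscretization K L e lam w mu η) {n : Fin m}
    {r : ℝ} (hr : 0 ≤ r) (hmr : mu n + η ≤ r ^ 2) (u : E) :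
    ‖L.adjoint (diagOp Finset.univ w (tailInd n) u)‖ ≤
      r * ‖diagOp Finset.univ w (tailInd n) u‖ := by
  refine abs_le_of_sq_le_sq' ?_ (by positivity) |>.2
  refine (h.norm_sq_adjoint_diagOp_le _ u).trans ?_
  rw [mul_pow, norm_sq_diagOp w.orthonormal, Finset.mul_sum]
  refine Finset.sum_le_sum fun j _ => ?_
  unfold tailInd
  split_ifs with hj
  · simp
  · have := h.mu_antitone (not_le.1 hj).le
    nlinarith [sq_nonneg ⟪w j, u⟫]

/-- The part of the leading singular functions that the discretization moves beyond the
truncation level. -/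
lemma norm_tail_comp_le (h : IsDiscretization K L e lam w mu η) {n : Fin m} {q : ℕ} {ℓ C : ℝ}
    (hC : 0 ≤ C) (hL : ∀ x, ‖L x‖ ≤ C * ‖x‖) (hℓ : ∀ i < q, ℓ ≤ lam i) (hmu : mu n < ℓ) (x : H) :
    ‖diagOp Finset.univ w (tailInd n) (L (diagOp (Finset.range q) e (fun _ => 1) x))‖ ≤
      2 * η * C / (ℓ - mu n) * ‖x‖ := by
  have hη := h.eta_nonneg
  have hmun := h.mu_nonneg n
  have hℓ0 : 0 < ℓ := hmun.trans_lt hmu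
  set Q := diagOp (Finset.range q) e (fun _ => 1) with hQ
  set T := diagOp Finset.univ w (tailInd n) with hT
  set X := T ∘L L ∘L Q with hX
  have hTle : ∀ u, ‖T u‖ ≤ ‖u‖ := fun u => by
    simpa using norm_diagOp_le w.orthonormal Finset.univ (tailInd n) zero_le_one
      (fun i _ => by unfold tailInd; split_ifs <;> simp) u
  -- A Sylvester equation argument: `X` almost intertwines `K† K` on the range of `Q`, where it is
  -- at least `ℓ`, with B on the range of `T`, where it is at most `mu n`. Hence `ℓ ‖X‖ ≤ mu n ‖X‖ +
  -- 2 η C`, and the gap `ℓ - mu n` allows `‖X‖` to be solved for.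
  have key : ‖X‖ ≤ (mu n * ‖X‖ + 2 * η * C) / ℓ := by
    refine ContinuousLinearMap.opNorm_le_bound _ (by positivity) fun x => ?_
    -- `y` solves `K† K y = Q x`. Thus `Q x` is `L† L y` up to `η ‖y‖`, and `L Q x` is `B L y` up to
    -- the two errors collected below.
    set y := diagOp (Finset.range q) e (fun i => 1 / lam i) x with hy
    have hyx : ‖y‖ ≤ 1 / ℓ * ‖x‖ := by
      refine norm_diagOp_le h.orthonormal _ _ (by positivity) (fun i hi => ?_) x
      have := hℓ i (Finset.mem_range.1 hi)
      rw [abs_of_nonneg (by have := h.lam_nonneg i; positivity)]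
      exact one_div_le_one_div_of_le hℓ0 this
    have hQy : Q y = y := by
      rw [hQ, hy, diagOp_diagOp h.orthonormal]
      exact diagOp_congr (fun i _ => one_mul _) x
    have hd : ‖Q x - L.adjoint (L y)‖ ≤ η * ‖y‖ := by
      refine h.norm_map_sub_le fun g => ?_
      rw [hy, h.map_form_diagOp]
      congr 1
      refine diagOp_congr (fun i hi => ?_) x
      have := hℓ0.trans_le (hℓ i (Finset.mem_range.1 hi))
      field_simp
    have hr := h.norm_adjoint_sub_le (L y)
    have hB : T (diagOp Finset.univ w mu (L y)) =
        diagOp Finset.univ w (fun j => tailInd n j * mu j) (X y) := by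
      rw [hX, ContinuousLinearMap.comp_apply, ContinuousLinearMap.comp_apply, hQy, hT,
        diagOp_diagOp w.orthonormal, diagOp_diagOp w.orthonormal]
      refine diagOp_congr (fun j _ => ?_) _
      unfold tailInd
      split_ifs <;> ring
    have hBn : ‖T (diagOp Finset.univ w mu (L y))‖ ≤ mu n * (‖X‖ * ‖y‖) := by
      rw [hB]
      refine (norm_diagOp_le w.orthonormal _ _ hmun (fun j _ => ?_) _).trans
        (mul_le_mul_of_nonneg_left (X.le_opNorm y) hmun)
      unfold tailInd
      split_ifs with hj
      · simpa using hmun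
      · rw [one_mul, abs_of_nonneg (h.mu_nonneg j)]
        exact h.mu_antitone (not_le.1 hj).le
    have hsplit : X x = T (diagOp Finset.univ w mu (L y)) +
        (T (L (L.adjoint (L y)) - diagOp Finset.univ w mu (L y)) +
          T (L (Q x - L.adjoint (L y)))) := by
      simp only [hX, ContinuousLinearMap.comp_apply, map_sub]
      abel
    have h1 : ‖T (L (L.adjoint (L y)) - diagOp Finset.univ w mu (L y))‖ ≤ η * (C * ‖y‖) :=
      (hTle _).trans (hr.trans (mul_le_mul_of_nonneg_left (hL y) hη))
    have h2 : ‖T (L (Q x - L.adjoint (L y)))‖ ≤ C * (η * ‖y‖) :=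
      (hTle _).trans ((hL _).trans (mul_le_mul_of_nonneg_left hd hC))
    have h3 : ‖X x‖ ≤ (mu n * ‖X‖ + 2 * η * C) * ‖y‖ := by
      rw [hsplit]
      refine (norm_add_le _ _).trans ?_
      have := norm_add_le (T (L (L.adjoint (L y)) - diagOp Finset.univ w mu (L y)))
        (T (L (Q x - L.adjoint (L y))))
      linarith
    calc ‖X x‖ ≤ (mu n * ‖X‖ + 2 * η * C) * ‖y‖ := h3
      _ ≤ (mu n * ‖X‖ + 2 * η * C) * (1 / ℓ * ‖x‖) := by gcongr
      _ = _ := by ring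
  have hXle : ‖X‖ ≤ 2 * η * C / (ℓ - mu n) := by
    rw [le_div_iff₀ (sub_pos.2 hmu)]
    rw [le_div_iff₀ hℓ0] at key
    linarith
  exact X.le_of_opNorm_le hXle x

/-- The spectral cut-off operator almost reproduces the leading singular functions. -/
lemma norm_cutoff_sub_leading_le (h : IsDiscretization K L e lam w mu η) {n : Fin m} {q : ℕ}
    {τ c C : ℝ} (hL : ∀ x, ‖L x‖ ≤ C * ‖x‖) (hτ : 0 < τ) (hτC : τ ≤ C) (hlam : lam n = τ ^ 2)
    (hc : 0 < c) (hcτ : c ≤ τ ^ 2) (hηc : 10 * η ≤ c) (hℓ : ∀ i < q, τ ^ 2 + c ≤ lam i) (f : H) :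
    ‖L.adjoint (diagOp Finset.univ w (truncInv mu n)
        (L (diagOp (Finset.range q) e (fun _ => 1) f))) -
      diagOp (Finset.range q) e (fun _ => 1) f‖ ≤ 6 * η * C / (c * τ) * ‖f‖ := by
  have hη := h.eta_nonneg
  have hC : 0 < C := hτ.trans_le hτC
  have hmu1 : mu n ≤ τ ^ 2 + 2 * η := hlam ▸ h.mu_le n
  have hmu2 : τ ^ 2 ≤ mu n + 2 * η := hlam ▸ h.lam_le n
  -- From `2 * η ≤ c / 5 ≤ τ ^ 2 / 5` one gets `mu n ≥ 4 / 5 * τ ^ 2`, which also gives `η ≤ mu n`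
  -- below.
  have hmupos : 0 < mu n := by nlinarith
  set Q := diagOp (Finset.range q) e (fun _ => 1) with hQ
  set S := diagOp Finset.univ w (truncInv mu n) with hS
  -- Source representation of the leading part: `Q f = K† K y`, so `Q f = L† L y + d` with `d`
  -- small.
  set y := diagOp (Finset.range q) e (fun i => 1 / lam i) f with hy
  have hyf : ‖y‖ ≤ 1 / τ ^ 2 * ‖f‖ := by
    refine norm_diagOp_le h.orthonormal _ _ (by positivity) (fun i hi => ?_) f
    have := hℓ i (Finset.mem_range.1 hi)
    rw [abs_of_nonneg (by have := h.lam_nonneg i; positivity)]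
    exact one_div_le_one_div_of_le (by positivity) (by linarith)
  have hQy : Q y = y := by
    rw [hQ, hy, diagOp_diagOp h.orthonormal]
    exact diagOp_congr (fun i _ => one_mul _) f
  set d := Q f - L.adjoint (L y) with hd
  have hdle : ‖d‖ ≤ η * ‖y‖ := by
    refine h.norm_map_sub_le fun g => ?_
    rw [hy, h.map_form_diagOp]
    congr 1
    refine diagOp_congr (fun i hi => ?_) f
    have : 0 < lam i := by have := hℓ i (Finset.mem_range.1 hi); nlinarith
    field_simp
  set r := L (L.adjoint (L y)) - diagOp Finset.univ w mu (L y) with hr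
  have hrle : ‖r‖ ≤ η * (C * ‖y‖) :=
    (h.norm_adjoint_sub_le (L y)).trans (mul_le_mul_of_nonneg_left (hL y) hη)
  -- On the eigenbasis of B, truncated inversion after B removes exactly the tail: `S B = I - T`.
  have hSB : S (diagOp Finset.univ w mu (L y)) = L y - diagOp Finset.univ w (tailInd n) (L y) := by
    have hLy : L y = diagOp Finset.univ w (fun _ => 1) (L y) := by
      rw [diagOp_apply]
      simp only [one_mul]
      exact (w.sum_repr' (L y)).symm
    rw [hS, diagOp_diagOp w.orthonormal]
    nth_rewrite 2 [hLy]
    rw [diagOp_apply, diagOp_apply, diagOp_apply, ← Finset.sum_sub_distrib]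
    refine Finset.sum_congr rfl fun j _ => ?_
    rw [← sub_smul]
    congr 1
    unfold truncInv tailInd
    split_ifs with hj
    · have : 0 < mu j := hmupos.trans_le (h.mu_antitone hj)
      field_simp
      ring
    · ring
  -- The main terms `L† L y` cancel. What remains is the contraction applied to `d`, the mismatch
  -- `r` between `L L†` and B, and the part of `L y` lost in the tail.
  have hsplit : L.adjoint (S (L (Q f))) - Q f =
      (L.adjoint (S (L d)) - d) + (L.adjoint (S r) -
        L.adjoint (diagOp Finset.univ w (tailInd n) (L y))) := by
    have hQf : Q f = d + L.adjoint (L y) := by rw [hd]; abel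
    have h1 : L (L.adjoint (L y)) = diagOp Finset.univ w mu (L y) + r := by rw [hr]; abel
    rw [hQf]
    simp only [map_add, h1, hSB, map_sub]
    abel
  -- Here `mu n + η ≤ τ ^ 2 + 3 * η ≤ 13 / 10 * τ ^ 2`, below `36 / 25 * τ ^ 2`.
  have hmr : mu n + η ≤ (6 / 5 * τ) ^ 2 := by nlinarith
  have e1 : ‖L.adjoint (S (L d)) - d‖ ≤ η * ‖y‖ :=
    (h.norm_cutoff_sub_le hmupos (by nlinarith) d).trans hdle
  have e2 : ‖L.adjoint (S r)‖ ≤ (6 / 5 * τ) / mu n * (η * (C * ‖y‖)) :=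
    (h.norm_adjoint_truncInv_le hmupos (by positivity) hmr r).trans (by gcongr)
  have e3 : ‖L.adjoint (diagOp Finset.univ w (tailInd n) (L y))‖ ≤
      (6 / 5 * τ) * (2 * η * C / (τ ^ 2 + c - mu n) * ‖y‖) := by
    refine (h.norm_adjoint_tail_le (by positivity) hmr (L y)).trans ?_
    gcongr
    have := h.norm_tail_comp_le (n := n) hC.le hL hℓ (by linarith) y
    rwa [← hQ, hQy] at this
  have e2' : (6 / 5 * τ) / mu n ≤ 3 / 2 / τ := by
    rw [div_le_div_iff₀ hmupos hτ]
    nlinarith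
  -- The perturbed gap keeps four fifths of `c`, because `mu n ≤ τ ^ 2 + 2 * η` and `10 * η ≤ c`.
  have e3' : 2 * η * C / (τ ^ 2 + c - mu n) ≤ 5 / 2 * η * C / c := by
    rw [div_le_div_iff₀ (by linarith) hc]
    have : 0 ≤ η * C := by positivity
    nlinarith
  calc ‖L.adjoint (S (L (Q f))) - Q f‖
      ≤ η * ‖y‖ + ((6 / 5 * τ) / mu n * (η * (C * ‖y‖)) +
        (6 / 5 * τ) * (2 * η * C / (τ ^ 2 + c - mu n) * ‖y‖)) := by
        rw [hsplit]
        exact (norm_add_le _ _).trans (add_le_add e1 ((norm_sub_le _ _).trans (add_le_add e2 e3)))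
    _ ≤ η * ‖y‖ + (3 / 2 / τ * (η * (C * ‖y‖)) +
        (6 / 5 * τ) * (5 / 2 * η * C / c * ‖y‖)) := by gcongr
    _ = (η + 3 / 2 / τ * η * C + 3 * τ * η * C / c) * ‖y‖ := by ring
    _ ≤ (η + 3 / 2 / τ * η * C + 3 * τ * η * C / c) * (1 / τ ^ 2 * ‖f‖) := by gcongr
    _ = (η * (c * τ) + 3 / 2 * (c * η * C) + 3 * τ ^ 2 * η * C) / (c * τ ^ 3) * ‖f‖ := by
        field_simp
    -- The three contributions are at most `1`, `3 / 2` and `3` times `τ ^ 2 * η * C`, using `c ≤ τ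
    -- ^ 2` and `τ ≤ C`; their sum `11 / 2` is rounded up to `6`.
    _ ≤ (6 * η * C * τ ^ 2) / (c * τ ^ 3) * ‖f‖ := by
        gcongr
        have i1 : η * (c * τ) ≤ η * (τ ^ 2 * C) := by gcongr
        have i2 : c * η * C ≤ τ ^ 2 * η * C := by gcongr
        have : 0 ≤ τ ^ 2 * η * C := by positivity
        linarith
    _ = _ := by field_simp

/-- The bias of the spectral cut-off estimator. -/
lemma norm_bias_le (h : IsDiscretization K L e lam w mu η) {n : Fin m} {q p : ℕ}
    (hqp : q ≤ p) {τ c C : ℝ} (hL : ∀ x, ‖L x‖ ≤ C * ‖x‖) (hτ : 0 < τ) (hτC : τ ≤ C)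
    (hlam : lam n = τ ^ 2) (hc : 0 < c) (hcτ : c ≤ τ ^ 2) (hηc : 10 * η ≤ c)
    (hℓ : ∀ i < q, τ ^ 2 + c ≤ lam i) {f : H}
    (hf : f ∈ (Submodule.span ℝ (Set.range e)).topologicalClosure) :
    ‖L.adjoint (diagOp Finset.univ w (truncInv mu n) (L f)) - f‖ ≤
      √(∑' j, ⟪f, e (p + j)⟫ ^ 2) + √(∑ j ∈ Finset.Ico q p, ⟪f, e j⟫ ^ 2) +
        6 * η * C / (c * τ) * ‖f‖ := by
  have hη := h.eta_nonneg
  have hmu2 : τ ^ 2 ≤ mu n + 2 * η := hlam ▸ h.lam_le n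
  have hmupos : 0 < mu n := by nlinarith
  obtain ⟨g, hg, hgo⟩ := exists_hasSum_inner_smul h.orthonormal f
  -- The difference lies both in the closed span of the `e i` and in its orthogonal complement.
  -- Without `hf`, a component of `f` in the kernel of `K` would survive in the bias.
  have hfg : f = g := by
    have hmem : f - g ∈ (Submodule.span ℝ (Set.range e)).topologicalClosure := by
      refine Submodule.sub_mem _ hf ?_
      refine (Submodule.isClosed_topologicalClosure _).mem_of_tendsto hg ?_
      refine Filter.Eventually.of_forall fun t => Submodule.le_topologicalClosure _ ?_
      exact Submodule.sum_mem _ fun i _ => Submodule.smul_mem _ _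
        (Submodule.subset_span (Set.mem_range_self i))
    have hperp : f - g ∈ (Submodule.span ℝ (Set.range e))ᗮ := by
      rw [Submodule.mem_orthogonal]
      intro u hu
      induction hu using Submodule.span_induction with
      | mem x hx => obtain ⟨i, rfl⟩ := hx; exact hgo i
      | zero => exact inner_zero_left _
      | add x y _ _ hx hy => rw [inner_add_left, hx, hy, add_zero]
      | smul a x _ hx => rw [real_inner_smul_left, hx, mul_zero]
    rw [← Submodule.orthogonal_closure] at hperp
    have := Submodule.inner_right_of_mem_orthogonal hmem hperp
    exact sub_eq_zero.1 (inner_self_eq_zero.1 this)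
  set Q := diagOp (Finset.range q) e (fun _ => 1) with hQ
  set D := diagOp (Finset.Ico q p) e (fun _ => 1) with hD
  have hDn : ‖D f‖ = √(∑ j ∈ Finset.Ico q p, ⟪f, e j⟫ ^ 2) := by
    rw [eq_comm, Real.sqrt_eq_iff_eq_sq (Finset.sum_nonneg fun _ _ => sq_nonneg _)
      (norm_nonneg _), hD, norm_sq_diagOp h.orthonormal]
    exact Finset.sum_congr rfl fun j _ => by rw [real_inner_comm]; ring
  have hQD : Q f + D f = ∑ i ∈ Finset.range p, ⟪e i, f⟫ • e i := by
    rw [hQ, hD, diagOp_apply, diagOp_apply]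
    simp only [one_mul]
    exact Finset.sum_range_add_sum_Ico _ hqp
  have hrest : ‖f - (Q f + D f)‖ ≤ √(∑' j, ⟪f, e (p + j)⟫ ^ 2) := by
    have hsum : Summable fun j => ⟪f, e (p + j)⟫ ^ 2 := by
      have := (summable_nat_add_iff p).2 (h.orthonormal.inner_products_summable f)
      refine this.congr fun j => ?_
      rw [real_inner_comm, Real.norm_eq_abs, sq_abs, add_comm]
    have hlim := (hg.tendsto_sum_nat.sub_const (Q f + D f)).norm
    rw [← hfg] at hlim
    refine le_of_tendsto hlim ?_
    filter_upwards [Filter.eventually_ge_atTop p] with N hN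
    have h1 : ∑ i ∈ Finset.range N, ⟪e i, f⟫ • e i - (Q f + D f) =
        diagOp (Finset.Ico p N) e (fun _ => 1) f := by
      rw [hQD, diagOp_apply, sub_eq_iff_eq_add']
      simp only [one_mul]
      exact (Finset.sum_range_add_sum_Ico _ hN).symm
    rw [h1]
    refine Real.le_sqrt_of_sq_le ?_
    rw [norm_sq_diagOp h.orthonormal, Finset.sum_Ico_eq_sum_range]
    refine le_trans (le_of_eq ?_) (hsum.sum_le_tsum (Finset.range (N - p)) fun _ _ => sq_nonneg _)
    exact Finset.sum_congr rfl fun j _ => by rw [real_inner_comm]; ring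
  -- Only the part `Q f`, separated from the cut-off by a gap, needs the perturbation estimate; for
  -- the remainder and the block `D f` the contraction property costs a factor one.
  have hsplit : L.adjoint (diagOp Finset.univ w (truncInv mu n) (L f)) - f =
      (L.adjoint (diagOp Finset.univ w (truncInv mu n) (L (f - (Q f + D f)))) -
        (f - (Q f + D f))) +
      (L.adjoint (diagOp Finset.univ w (truncInv mu n) (L (D f))) - D f) +
      (L.adjoint (diagOp Finset.univ w (truncInv mu n) (L (Q f))) - Q f) := by
    simp only [map_sub, map_add]
    abel
  rw [hsplit]
  refine (norm_add₃_le).trans (add_le_add (add_le_add ?_ ?_) ?_)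
  · exact (h.norm_cutoff_sub_le hmupos (by nlinarith) _).trans hrest
  · exact (h.norm_cutoff_sub_le hmupos (by nlinarith) _).trans hDn.le
  · exact h.norm_cutoff_sub_leading_le hL hτ hτC hlam hc hcτ hηc hℓ f

end IsDiscretization

/-! ### Taylor bounds and the midpoint rule -/

section Calculus

/-- `a` and its first and second order increments on `[0,1]` are controlled by `A`. -/
def TaylorBound (a : ℝ → ℝ) (A : ℝ) : Prop :=
  (∀ t ∈ Set.Icc (0 : ℝ) 1, |a t| ≤ A) ∧ ∀ ξ ∈ Set.Icc (0 : ℝ) 1, ∃ d, |d| ≤ A ∧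
    ∀ t ∈ Set.Icc (0 : ℝ) 1, |a t - a ξ - d * (t - ξ)| ≤ A * (t - ξ) ^ 2

lemma TaylorBound.nonneg {a : ℝ → ℝ} {A : ℝ} (h : TaylorBound a A) : 0 ≤ A :=
  (abs_nonneg _).trans (h.1 0 (by simp))

lemma TaylorBound.continuousOn {a : ℝ → ℝ} {A : ℝ} (h : TaylorBound a A) :
    ContinuousOn a (Set.Icc 0 1) := by
  intro ξ hξ
  obtain ⟨d, hd, ht⟩ := h.2 ξ hξ
  rw [ContinuousWithinAt, tendsto_iff_dist_tendsto_zero]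
  have h0 : Filter.Tendsto (fun t => A * (t - ξ) ^ 2 + |d| * |t - ξ|)
      (nhdsWithin ξ (Set.Icc 0 1)) (nhds 0) := by
    have : Continuous fun t : ℝ => A * (t - ξ) ^ 2 + |d| * |t - ξ| := by fun_prop
    have h1 := this.tendsto ξ
    simp only [sub_self, abs_zero, mul_zero, ne_eq, OfNat.ofNat_ne_zero, not_false_eq_true,
      zero_pow, add_zero] at h1
    exact h1.mono_left nhdsWithin_le_nhds
  refine squeeze_zero' (Filter.Eventually.of_forall fun _ => dist_nonneg) ?_ h0
  filter_upwards [self_mem_nhdsWithin] with t htI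
  rw [Real.dist_eq]
  calc |a t - a ξ| = |(a t - a ξ - d * (t - ξ)) + d * (t - ξ)| := by ring_nf
    _ ≤ |a t - a ξ - d * (t - ξ)| + |d * (t - ξ)| := abs_add_le _ _
    _ ≤ _ := by rw [abs_mul]; exact add_le_add_left (ht t htI) _

/-- First order Taylor expansion with a crude remainder. -/
lemma abs_taylor_le {g g' g'' : ℝ → ℝ} {D : ℝ}
    (hg : ∀ t ∈ Set.Icc (0 : ℝ) 1, HasDerivWithinAt g (g' t) (Set.Icc 0 1) t)
    (hg' : ∀ t ∈ Set.Icc (0 : ℝ) 1, HasDerivWithinAt g' (g'' t) (Set.Icc 0 1) t)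
    (hD : ∀ t ∈ Set.Icc (0 : ℝ) 1, |g'' t| ≤ D) {ξ t : ℝ} (hξ : ξ ∈ Set.Icc (0 : ℝ) 1)
    (ht : t ∈ Set.Icc (0 : ℝ) 1) : |g t - g ξ - g' ξ * (t - ξ)| ≤ D * (t - ξ) ^ 2 := by
  have hD0 : 0 ≤ D := (abs_nonneg _).trans (hD ξ hξ)
  have hsub : Set.uIcc ξ t ⊆ Set.Icc 0 1 := Set.uIcc_subset_Icc hξ ht
  have h1 : ∀ s ∈ Set.uIcc ξ t, ‖g' s - g' ξ‖ ≤ D * |t - ξ| := fun s hs => by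
    have := (convex_Icc (0 : ℝ) 1).norm_image_sub_le_of_norm_hasDerivWithin_le hg'
      (fun x hx => hD x hx) hξ (hsub hs)
    refine this.trans (mul_le_mul_of_nonneg_left ?_ hD0)
    rw [Real.norm_eq_abs]
    exact Set.abs_sub_left_of_mem_uIcc hs
  have h2 : ∀ s ∈ Set.uIcc ξ t,
      HasDerivWithinAt (fun s => g s - g' ξ * s) (g' s - g' ξ) (Set.uIcc ξ t) s := fun s hs => by
    have h3 := ((hasDerivAt_id s).const_mul (g' ξ)).hasDerivWithinAt (s := Set.uIcc ξ t)
    simpa using ((hg s (hsub hs)).mono hsub).fun_sub h3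
  have := (convex_uIcc ξ t).norm_image_sub_le_of_norm_hasDerivWithin_le h2 h1
    Set.left_mem_uIcc Set.right_mem_uIcc
  calc |g t - g ξ - g' ξ * (t - ξ)| = ‖g t - g' ξ * t - (g ξ - g' ξ * ξ)‖ := by
        rw [Real.norm_eq_abs]; ring_nf
    _ ≤ D * |t - ξ| * ‖t - ξ‖ := this
    _ = D * (t - ξ) ^ 2 := by rw [Real.norm_eq_abs, mul_assoc, abs_mul_abs_self]; ring

/-- The remainder is arranged so that the full factors, bounded by `A` and `B`, appear instead of
their Taylor polynomials. It then has four terms of size `A * B * τ ^ 2`; `τ ^ 2 ≤ 1` is needed only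
for the product of the two remainders. -/
lemma abs_mul_taylor_le {a0 a1 ra b0 b1 rb τ A B : ℝ} (hA : 0 ≤ A) (hB : 0 ≤ B)
    (ha : |a0 + a1 * τ + ra| ≤ A) (ha1 : |a1| ≤ A) (hra : |ra| ≤ A * τ ^ 2)
    (hb : |b0 + b1 * τ + rb| ≤ B) (hb1 : |b1| ≤ B) (hrb : |rb| ≤ B * τ ^ 2) (hτ : τ ^ 2 ≤ 1) :
    |(a0 + a1 * τ + ra) * (b0 + b1 * τ + rb) - a0 * b0 - (a1 * b0 + a0 * b1) * τ| ≤
      4 * (A * B * τ ^ 2) := by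
  have h : (a0 + a1 * τ + ra) * (b0 + b1 * τ + rb) - a0 * b0 - (a1 * b0 + a0 * b1) * τ =
      a1 * b1 * τ ^ 2 + (ra * (b0 + b1 * τ + rb) + ((a0 + a1 * τ + ra) * rb + -(ra * rb))) := by
    ring
  have hτ0 := sq_nonneg τ
  have e1 : |a1 * b1 * τ ^ 2| ≤ A * B * τ ^ 2 := by
    rw [abs_mul, abs_mul, abs_of_nonneg hτ0]; gcongr
  have e2 : |ra * (b0 + b1 * τ + rb)| ≤ A * τ ^ 2 * B := by
    rw [abs_mul]; gcongr
  have e3 : |(a0 + a1 * τ + ra) * rb| ≤ A * (B * τ ^ 2) := by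
    rw [abs_mul]; gcongr
  have e4 : |-(ra * rb)| ≤ A * τ ^ 2 * (B * 1) := by
    rw [abs_neg, abs_mul]
    gcongr
    exact hrb.trans (by gcongr)
  rw [h]
  refine (abs_add_le _ _).trans ?_
  have := abs_add_le (ra * (b0 + b1 * τ + rb)) ((a0 + a1 * τ + ra) * rb + -(ra * rb))
  have := abs_add_le ((a0 + a1 * τ + ra) * rb) (-(ra * rb))
  linarith

lemma grid_eq (m : ℕ) (l : Fin m) : grid m l = ((l : ℝ) + 1 / 2) / m := by
  have : (m : ℝ) ≠ 0 := by
    have := l.pos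
    positivity
  unfold grid
  field_simp
  ring

lemma grid_mem (m : ℕ) (l : Fin m) : grid m l ∈ Set.Icc (0 : ℝ) 1 := by
  have hm : (0 : ℝ) < m := by exact_mod_cast l.pos
  have hl : (l : ℝ) + 1 ≤ m := by exact_mod_cast l.2
  rw [grid_eq]
  exact ⟨by positivity, by rw [div_le_one hm]; linarith⟩

lemma integral_unitMeasure (g : ℝ → ℝ) : ∫ t, g t ∂unitMeasure = ∫ t in (0 : ℝ)..1, g t := by
  rw [intervalIntegral.integral_of_le zero_le_one, integral_Ioc_eq_integral_Ioo]

/-- The midpoint rule for a product. -/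
lemma abs_midpoint_le {a b : ℝ → ℝ} {A B : ℝ} (ha : TaylorBound a A) (hb : TaylorBound b B)
    {m : ℕ} (hm : 1 ≤ m) :
    |∫ t, a t * b t ∂unitMeasure - 1 / (m : ℝ) * ∑ l, a (grid m l) * b (grid m l)| ≤
      A * B / m ^ 2 := by
  have hm0 : (0 : ℝ) < m := by exact_mod_cast hm
  have hm1 : (1 : ℝ) ≤ m := by exact_mod_cast hm
  have hAB : 0 ≤ A * B := mul_nonneg ha.nonneg hb.nonneg
  have hcont : ContinuousOn (fun t => a t * b t) (Set.Icc 0 1) :=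
    ha.continuousOn.mul hb.continuousOn
  have hmem : ∀ l : ℕ, l ≤ m → (l : ℝ) / m ∈ Set.Icc (0 : ℝ) 1 := fun l hl =>
    ⟨by positivity, by rw [div_le_one hm0]; exact_mod_cast hl⟩
  have hint : ∀ l < m, IntervalIntegrable (fun t => a t * b t) volume ((l : ℝ) / m)
      (((l + 1 : ℕ) : ℝ) / m) := fun l hl =>
    (hcont.mono (Set.uIcc_subset_Icc (hmem l hl.le) (hmem (l + 1) hl))).intervalIntegrable
  have hsum := intervalIntegral.sum_integral_adjacent_intervals (a := fun l : ℕ => (l : ℝ) / m) hint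
  have hends : ((0 : ℕ) : ℝ) / m = 0 ∧ ((m : ℕ) : ℝ) / m = 1 := ⟨by simp, div_self hm0.ne'⟩
  rw [integral_unitMeasure]
  simp only [hends.1, hends.2] at hsum
  rw [← hsum, Finset.sum_range, Finset.mul_sum, ← Finset.sum_sub_distrib]
  have hcell : ∀ l : Fin m, |(∫ t in ((l : ℕ) : ℝ) / m..(((l : ℕ) + 1 : ℕ) : ℝ) / m, a t * b t) -
      1 / (m : ℝ) * (a (grid m l) * b (grid m l))| ≤ A * B / m ^ 2 * (1 / m) := by
    intro l
    set u := ((l : ℕ) : ℝ) / m with hu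
    set u' := (((l : ℕ) + 1 : ℕ) : ℝ) / m with hu'
    set ξ := grid m l with hξ
    have hξe : ξ = (u + u') / 2 := by
      rw [hξ, grid_eq, hu, hu']; push_cast; ring
    have hlen : u' - u = 1 / m := by rw [hu, hu']; push_cast; ring
    obtain ⟨d, hd, hda⟩ := ha.2 ξ (grid_mem m l)
    obtain ⟨d', hd', hdb⟩ := hb.2 ξ (grid_mem m l)
    -- The linear term integrates to zero because `ξ` is the midpoint of the cell.
    have hlin : ∫ t in u..u', (d * b ξ + a ξ * d') * (t - ξ) = 0 := by
      rw [intervalIntegral.integral_const_mul, intervalIntegral.integral_sub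
        (by simp) (by simp), integral_id, intervalIntegral.integral_const, hξe]
      simp only [smul_eq_mul]
      ring
    have hconst : ∫ _ in u..u', a ξ * b ξ = 1 / (m : ℝ) * (a ξ * b ξ) := by
      rw [intervalIntegral.integral_const, hlen, smul_eq_mul]
    have hi := hint l l.2
    have heq : (∫ t in u..u', a t * b t) - 1 / (m : ℝ) * (a ξ * b ξ) =
        ∫ t in u..u', (a t * b t - a ξ * b ξ - (d * b ξ + a ξ * d') * (t - ξ)) := by
      rw [intervalIntegral.integral_sub (hi.sub (by simp))
        (Continuous.intervalIntegrable (by fun_prop) _ _),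
        intervalIntegral.integral_sub hi (by simp), hlin, hconst, sub_zero]
    rw [heq, ← Real.norm_eq_abs]
    have huu' : u ≤ u' := by
      have : 0 < 1 / (m : ℝ) := by positivity
      linarith
    have hbd : ∀ t ∈ Set.uIoc u u',
        ‖a t * b t - a ξ * b ξ - (d * b ξ + a ξ * d') * (t - ξ)‖ ≤ A * B / m ^ 2 := by
      intro t ht
      rw [Set.uIoc_of_le huu'] at ht
      have htI : t ∈ Set.Icc (0 : ℝ) 1 :=
        ⟨(hmem l l.2.le).1.trans ht.1.le, ht.2.trans (hmem (l + 1) l.2).2⟩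
      -- Bounding `(t - ξ) ^ 2` by its maximum on the cell gives `1 / (4 m ^ 2)`, which absorbs the
      -- factor `4` of `abs_mul_taylor_le` and leaves constant one.
      have hτ : (t - ξ) ^ 2 ≤ 1 / (4 * (m : ℝ) ^ 2) := by
        have : |t - ξ| ≤ 1 / (2 * m) := by
          have h2 : 1 / (2 * (m : ℝ)) = (1 / m) / 2 := by ring
          rw [abs_le, h2, ← hlen, hξe]
          constructor <;> linarith [ht.1, ht.2]
        calc (t - ξ) ^ 2 = |t - ξ| ^ 2 := (sq_abs _).symm
          _ ≤ (1 / (2 * m)) ^ 2 := by gcongr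
          _ = _ := by ring
      have hτ1 : (t - ξ) ^ 2 ≤ 1 := hτ.trans (by
        rw [div_le_one (by positivity)]
        nlinarith)
      have ea : a ξ + d * (t - ξ) + (a t - a ξ - d * (t - ξ)) = a t := by ring
      have eb : b ξ + d' * (t - ξ) + (b t - b ξ - d' * (t - ξ)) = b t := by ring
      have := abs_mul_taylor_le (a0 := a ξ) (a1 := d) (ra := a t - a ξ - d * (t - ξ))
        (b0 := b ξ) (b1 := d') (rb := b t - b ξ - d' * (t - ξ)) ha.nonneg hb.nonneg
        (by rw [ea]; exact ha.1 t htI) hd (hda t htI) (by rw [eb]; exact hb.1 t htI) hd'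
        (hdb t htI) hτ1
      rw [ea, eb] at this
      rw [Real.norm_eq_abs]
      calc _ ≤ 4 * (A * B * (t - ξ) ^ 2) := this
        _ ≤ 4 * (A * B * (1 / (4 * (m : ℝ) ^ 2))) := by gcongr
        _ = _ := by field_simp
    have := intervalIntegral.norm_integral_le_of_norm_le_const hbd
    rwa [hlen, abs_of_nonneg (by positivity)] at this
  calc _ ≤ ∑ l : Fin m, A * B / m ^ 2 * (1 / m) :=
        (Finset.abs_sum_le_sum_abs _ _).trans (Finset.sum_le_sum fun l _ => hcell l)
    _ = A * B / m ^ 2 := by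
        rw [Finset.sum_const, Finset.card_univ, Fintype.card_fin, nsmul_eq_mul]
        field_simp

end Calculus

/-! ### Partial derivatives of the kernel and the constant `C_K` -/

section Kernel

/-- The closed unit square. -/
abbrev unitSq : Set (ℝ × ℝ) := Set.Icc (0 : ℝ) 1 ×ˢ Set.Icc (0 : ℝ) 1

lemma uniqueDiffOn_unitSq : UniqueDiffOn ℝ unitSq :=
  (uniqueDiffOn_Icc zero_lt_one).prod (uniqueDiffOn_Icc zero_lt_one)

/-- Taking the partial derivative from the Fréchet derivative within the square keeps it jointly
regular, so the construction can be iterated and yields continuity on a compact set. -/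
lemma exists_partial_fst {F : ℝ × ℝ → ℝ} {n : ℕ} (hF : ContDiffOn ℝ (n + 1 : ℕ) F unitSq) :
    ∃ G : ℝ × ℝ → ℝ, ContDiffOn ℝ n G unitSq ∧ ∀ x ∈ Set.Icc (0 : ℝ) 1, ∀ y ∈ Set.Icc (0 : ℝ) 1,
      HasDerivWithinAt (fun s => F (s, y)) (G (x, y)) (Set.Icc 0 1) x := by
  refine ⟨fun p => fderivWithin ℝ F unitSq p (1, 0), ?_, fun x hx y hy => ?_⟩
  · exact (hF.fderivWithin uniqueDiffOn_unitSq (by norm_cast)).clm_apply contDiffOn_const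
  · have h1 : HasFDerivWithinAt F (fderivWithin ℝ F unitSq (x, y)) unitSq (x, y) :=
      ((hF.differentiableOn (by simp)) (x, y) ⟨hx, hy⟩).hasFDerivWithinAt
    have h2 : HasDerivWithinAt (fun s : ℝ => (s, y)) ((1 : ℝ), (0 : ℝ)) (Set.Icc 0 1) x :=
      (hasDerivWithinAt_id x _).prodMk (hasDerivWithinAt_const x _ y)
    exact h1.comp_hasDerivWithinAt x h2 fun s hs => Set.mk_mem_prod hs hy

lemma exists_partial_snd {F : ℝ × ℝ → ℝ} {n : ℕ} (hF : ContDiffOn ℝ (n + 1 : ℕ) F unitSq) :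
    ∃ G : ℝ × ℝ → ℝ, ContDiffOn ℝ n G unitSq ∧ ∀ x ∈ Set.Icc (0 : ℝ) 1, ∀ y ∈ Set.Icc (0 : ℝ) 1,
      HasDerivWithinAt (fun t => F (x, t)) (G (x, y)) (Set.Icc 0 1) y := by
  refine ⟨fun p => fderivWithin ℝ F unitSq p (0, 1), ?_, fun x hx y hy => ?_⟩
  · exact (hF.fderivWithin uniqueDiffOn_unitSq (by norm_cast)).clm_apply contDiffOn_const
  · have h1 : HasFDerivWithinAt F (fderivWithin ℝ F unitSq (x, y)) unitSq (x, y) :=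
      ((hF.differentiableOn (by simp)) (x, y) ⟨hx, hy⟩).hasFDerivWithinAt
    have h2 : HasDerivWithinAt (fun t : ℝ => (x, t)) ((0 : ℝ), (1 : ℝ)) (Set.Icc 0 1) y :=
      (hasDerivWithinAt_const y _ x).prodMk (hasDerivWithinAt_id y _)
    exact h1.comp_hasDerivWithinAt y h2 fun s hs => Set.mk_mem_prod hx hs

lemma iteratedDerivWithin_one_eq {g g' : ℝ → ℝ} {x : ℝ} (hx : x ∈ Set.Icc (0 : ℝ) 1)
    (h1 : ∀ t ∈ Set.Icc (0 : ℝ) 1, HasDerivWithinAt g (g' t) (Set.Icc 0 1) t) :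
    iteratedDerivWithin 1 g (Set.Icc 0 1) x = g' x := by
  rw [iteratedDerivWithin_one]
  exact (h1 x hx).derivWithin (uniqueDiffOn_Icc zero_lt_one x hx)

lemma iteratedDerivWithin_two_eq {g g' g'' : ℝ → ℝ} {x : ℝ} (hx : x ∈ Set.Icc (0 : ℝ) 1)
    (h1 : ∀ t ∈ Set.Icc (0 : ℝ) 1, HasDerivWithinAt g (g' t) (Set.Icc 0 1) t)
    (h2 : ∀ t ∈ Set.Icc (0 : ℝ) 1, HasDerivWithinAt g' (g'' t) (Set.Icc 0 1) t) :
    iteratedDerivWithin 2 g (Set.Icc 0 1) x = g'' x := by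
  rw [show (2 : ℕ) = 1 + 1 from rfl, iteratedDerivWithin_succ,
    derivWithin_congr (fun t ht => iteratedDerivWithin_one_eq ht h1)
      (iteratedDerivWithin_one_eq hx h1)]
  exact (h2 x hx).derivWithin (uniqueDiffOn_Icc zero_lt_one x hx)

/-- The bounds on the kernel that the error analysis uses. -/
structure KernelBound (κ : ℝ → ℝ → ℝ) (C : ℝ) : Prop where
  continuousOn : ContinuousOn (fun p : ℝ × ℝ => κ p.1 p.2) unitSq
  abs_le : ∀ x ∈ Set.Icc (0 : ℝ) 1, ∀ y ∈ Set.Icc (0 : ℝ) 1, |κ x y| ≤ C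
  fst : ∃ G : ℝ × ℝ → ℝ, ContinuousOn G unitSq ∧ ∀ y ∈ Set.Icc (0 : ℝ) 1,
    ∀ ξ ∈ Set.Icc (0 : ℝ) 1, |G (ξ, y)| ≤ C ∧ ∀ t ∈ Set.Icc (0 : ℝ) 1,
      |κ t y - κ ξ y - G (ξ, y) * (t - ξ)| ≤ C * (t - ξ) ^ 2
  snd : ∀ x ∈ Set.Icc (0 : ℝ) 1, TaylorBound (κ x) C

lemma kernelBound_derivBound {κ : ℝ → ℝ → ℝ}
    (hκ : ContDiffOn ℝ 2 (fun p : ℝ × ℝ => κ p.1 p.2) unitSq) :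
    KernelBound κ (derivBound κ) := by
  obtain ⟨Gx, hGx, hx⟩ := exists_partial_fst (n := 1) (by exact_mod_cast hκ)
  obtain ⟨Gy, hGy, hy⟩ := exists_partial_snd (n := 1) (by exact_mod_cast hκ)
  obtain ⟨Gxx, hGxx, hxx⟩ := exists_partial_fst (n := 0) (by exact_mod_cast hGx)
  -- `partialD` differentiates in `y` first, so the mixed derivative is the `x`-derivative of `Gy`.
  obtain ⟨Gxy, hGxy, hxy⟩ := exists_partial_fst (n := 0) (by exact_mod_cast hGy)
  obtain ⟨Gyy, hGyy, hyy⟩ := exists_partial_snd (n := 0) (by exact_mod_cast hGy)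
  have p00 : ∀ x ∈ Set.Icc (0 : ℝ) 1, ∀ y ∈ Set.Icc (0 : ℝ) 1, partialD κ 0 0 x y = κ x y :=
    fun x _ y _ => by simp [partialD]
  have p01 : ∀ x ∈ Set.Icc (0 : ℝ) 1, ∀ y ∈ Set.Icc (0 : ℝ) 1, partialD κ 0 1 x y = Gy (x, y) :=
    fun x hx' y hy' => by
      simp only [partialD, iteratedDerivWithin_zero]
      exact iteratedDerivWithin_one_eq hy' (hy x hx')
  have p02 : ∀ x ∈ Set.Icc (0 : ℝ) 1, ∀ y ∈ Set.Icc (0 : ℝ) 1, partialD κ 0 2 x y = Gyy (x, y) :=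
    fun x hx' y hy' => by
      simp only [partialD, iteratedDerivWithin_zero]
      exact iteratedDerivWithin_two_eq hy' (hy x hx') (hyy x hx')
  have p10 : ∀ x ∈ Set.Icc (0 : ℝ) 1, ∀ y ∈ Set.Icc (0 : ℝ) 1, partialD κ 1 0 x y = Gx (x, y) :=
    fun x hx' y hy' => by
      simp only [partialD, iteratedDerivWithin_zero]
      exact iteratedDerivWithin_one_eq hx' fun t ht => hx t ht y hy'
  have p20 : ∀ x ∈ Set.Icc (0 : ℝ) 1, ∀ y ∈ Set.Icc (0 : ℝ) 1, partialD κ 2 0 x y = Gxx (x, y) :=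
    fun x hx' y hy' => by
      simp only [partialD, iteratedDerivWithin_zero]
      exact iteratedDerivWithin_two_eq hx' (fun t ht => hx t ht y hy') fun t ht => hxx t ht y hy'
  have p11 : ∀ x ∈ Set.Icc (0 : ℝ) 1, ∀ y ∈ Set.Icc (0 : ℝ) 1, partialD κ 1 1 x y = Gxy (x, y) :=
    fun x hx' y hy' => by
      refine iteratedDerivWithin_one_eq (g' := fun t => Gxy (t, y)) hx' fun t ht => ?_
      refine (hxy t ht y hy').congr (fun s hs => ?_) ?_
      · exact iteratedDerivWithin_one_eq hy' (hy s hs)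
      · exact iteratedDerivWithin_one_eq hy' (hy t ht)
  have hcpt : IsCompact unitSq := isCompact_Icc.prod isCompact_Icc
  -- Boundedness must be established before the supremum defining `derivBound` can be used: the real
  -- `sSup` of an unbounded set is `0`.
  have hbd : ∀ n n' : ℕ, n + n' ≤ 2 → ∃ B, ∀ x ∈ Set.Icc (0 : ℝ) 1, ∀ y ∈ Set.Icc (0 : ℝ) 1,
      |partialD κ n n' x y| ≤ B := by
    have aux : ∀ (G : ℝ × ℝ → ℝ) (n n' : ℕ), ContinuousOn G unitSq →
        (∀ x ∈ Set.Icc (0 : ℝ) 1, ∀ y ∈ Set.Icc (0 : ℝ) 1, partialD κ n n' x y = G (x, y)) →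
        ∃ B, ∀ x ∈ Set.Icc (0 : ℝ) 1, ∀ y ∈ Set.Icc (0 : ℝ) 1, |partialD κ n n' x y| ≤ B := by
      intro G n n' hG hp
      obtain ⟨B, hB⟩ := hcpt.exists_bound_of_continuousOn hG
      exact ⟨B, fun x hx' y hy' => by rw [hp x hx' y hy']; exact hB (x, y) ⟨hx', hy'⟩⟩
    intro n n' hn
    have hn2 : n ≤ 2 := by omega
    interval_cases n
    · have : n' ≤ 2 := by omega
      interval_cases n'
      · exact aux _ 0 0 hκ.continuousOn p00
      · exact aux Gy 0 1 hGy.continuousOn p01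
      · exact aux Gyy 0 2 hGyy.continuousOn p02
    · have : n' ≤ 1 := by omega
      interval_cases n'
      · exact aux Gx 1 0 hGx.continuousOn p10
      · exact aux Gxy 1 1 hGxy.continuousOn p11
    · have : n' = 0 := by omega
      subst this
      exact aux Gxx 2 0 hGxx.continuousOn p20
  choose! B hB using hbd
  have hle : ∀ n n' : ℕ, n + n' ≤ 2 → ∀ x ∈ Set.Icc (0 : ℝ) 1, ∀ y ∈ Set.Icc (0 : ℝ) 1,
      |partialD κ n n' x y| ≤ derivBound κ := by
    intro n n' hn x hx' y hy'
    refine le_csSup ⟨∑ i ∈ Finset.range 3, ∑ j ∈ Finset.range 3, |B i j|, ?_⟩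
      ⟨x, hx', y, hy', n, n', hn, rfl⟩
    rintro _ ⟨x, hx', y, hy', n, n', hn, rfl⟩
    refine (hB n n' hn x hx' y hy').trans ((le_abs_self _).trans ?_)
    refine le_trans ?_ (Finset.single_le_sum (f := fun i => ∑ j ∈ Finset.range 3, |B i j|)
      (fun i _ => Finset.sum_nonneg fun j _ => abs_nonneg _)
      (Finset.mem_range.2 (by omega : n < 3)))
    exact Finset.single_le_sum (f := fun j => |B n j|) (fun j _ => abs_nonneg _)
      (Finset.mem_range.2 (by omega : n' < 3))
  refine ⟨hκ.continuousOn, fun x hx' y hy' => ?_, ⟨Gx, hGx.continuousOn, fun y hy' ξ hξ =>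
    ⟨?_, fun t ht => ?_⟩⟩, fun x hx' => ⟨fun t ht => ?_, fun ξ hξ => ⟨Gy (x, ξ), ?_, fun t ht => ?_⟩⟩⟩
  · rw [← p00 x hx' y hy']; exact hle 0 0 (by norm_num) x hx' y hy'
  · rw [← p10 ξ hξ y hy']; exact hle 1 0 (by norm_num) ξ hξ y hy'
  · exact abs_taylor_le (g := fun s => κ s y) (g' := fun s => Gx (s, y))
      (g'' := fun s => Gxx (s, y)) (fun s hs => hx s hs y hy') (fun s hs => hxx s hs y hy')
      (fun s hs => by rw [← p20 s hs y hy']; exact hle 2 0 (by norm_num) s hs y hy') hξ ht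
  · rw [← p00 x hx' t ht]; exact hle 0 0 (by norm_num) x hx' t ht
  · rw [← p01 x hx' ξ hξ]; exact hle 0 1 (by norm_num) x hx' ξ hξ
  · exact abs_taylor_le (g := κ x) (g' := fun s => Gy (x, s))
      (g'' := fun s => Gyy (x, s)) (fun s hs => hy x hx' s hs) (fun s hs => hyy x hx' s hs)
      (fun s hs => by rw [← p02 x hx' s hs]; exact hle 0 2 (by norm_num) x hx' s hs) hξ ht

end Kernel

/-! ### Continuous functions as elements of L²(0,1) -/

section L2

lemma measureReal_unitMeasure : unitMeasure.real Set.univ = 1 := by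
  simp [Measure.real]

lemma ae_unitMeasure {p : ℝ → Prop} (h : ∀ t ∈ Set.Icc (0 : ℝ) 1, p t) :
    ∀ᵐ t ∂unitMeasure, p t :=
  (ae_restrict_iff' measurableSet_Ioo).2
    (Filter.Eventually.of_forall fun t ht => h t (Set.Ioo_subset_Icc_self ht))

lemma memLp_of_continuousOn {φ : ℝ → ℝ} (hφ : ContinuousOn φ (Set.Icc 0 1)) :
    MemLp φ 2 unitMeasure := by
  obtain ⟨c, hc⟩ := isCompact_Icc.exists_bound_of_continuousOn hφ
  exact MemLp.of_bound
    ((hφ.mono Set.Ioo_subset_Icc_self).aestronglyMeasurable measurableSet_Ioo) c (ae_unitMeasure hc)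

/-- A function that is continuous on `[0,1]`, as an element of `L²(0,1)`. -/
noncomputable def toL2 (φ : ℝ → ℝ) (hφ : ContinuousOn φ (Set.Icc 0 1)) : L2 :=
  (memLp_of_continuousOn hφ).toLp φ

lemma coeFn_toL2 {φ : ℝ → ℝ} (hφ : ContinuousOn φ (Set.Icc 0 1)) :
    toL2 φ hφ =ᵐ[unitMeasure] φ := MemLp.coeFn_toLp _

lemma inner_L2 (f g : L2) : ⟪f, g⟫ = ∫ y, f y * g y ∂unitMeasure := by
  rw [L2.inner_def]
  exact integral_congr_ae (Filter.Eventually.of_forall fun y => by simp [mul_comm])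

lemma inner_toL2 {φ : ℝ → ℝ} (hφ : ContinuousOn φ (Set.Icc 0 1)) (f : L2) :
    ⟪toL2 φ hφ, f⟫ = ∫ y, φ y * f y ∂unitMeasure := by
  rw [inner_L2]
  refine integral_congr_ae ?_
  filter_upwards [coeFn_toL2 hφ] with y hy
  rw [hy]

lemma inner_toL2_toL2 {φ ψ : ℝ → ℝ} (hφ : ContinuousOn φ (Set.Icc 0 1))
    (hψ : ContinuousOn ψ (Set.Icc 0 1)) :
    ⟪toL2 φ hφ, toL2 ψ hψ⟫ = ∫ y, φ y * ψ y ∂unitMeasure := by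
  rw [inner_toL2]
  refine integral_congr_ae ?_
  filter_upwards [coeFn_toL2 hψ] with y hy
  rw [hy]

lemma norm_toL2_le {φ : ℝ → ℝ} (hφ : ContinuousOn φ (Set.Icc 0 1)) {c : ℝ}
    (hc : ∀ t ∈ Set.Icc (0 : ℝ) 1, |φ t| ≤ c) : ‖toL2 φ hφ‖ ≤ c := by
  have hc0 : 0 ≤ c := (abs_nonneg _).trans (hc 0 (by simp))
  refine abs_le_of_sq_le_sq' ?_ hc0 |>.2
  rw [← real_inner_self_eq_norm_sq, inner_toL2_toL2]
  have h : ∀ᵐ t ∂unitMeasure, ‖φ t * φ t‖ ≤ c ^ 2 := ae_unitMeasure fun t ht => by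
    rw [Real.norm_eq_abs, abs_mul, sq]
    exact mul_le_mul (hc t ht) (hc t ht) (abs_nonneg _) hc0
  have := norm_integral_le_of_norm_le_const h
  rw [measureReal_unitMeasure, mul_one] at this
  exact (le_abs_self _).trans this

lemma integrable_L2 (f : L2) : Integrable f unitMeasure :=
  (Lp.memLp f).integrable (by norm_num)

lemma integrable_mul_L2 {φ : ℝ → ℝ} (hφ : ContinuousOn φ (Set.Icc 0 1)) (f : L2) :
    Integrable (fun y => φ y * f y) unitMeasure :=
  (memLp_of_continuousOn hφ).integrable_mul (Lp.memLp f)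

lemma abs_integral_mul_le {φ : ℝ → ℝ} (hφ : ContinuousOn φ (Set.Icc 0 1)) {c : ℝ}
    (hc : ∀ t ∈ Set.Icc (0 : ℝ) 1, |φ t| ≤ c) (f : L2) :
    |∫ y, φ y * f y ∂unitMeasure| ≤ c * ‖f‖ := by
  rw [← inner_toL2 hφ]
  exact (abs_real_inner_le_norm _ _).trans
    (mul_le_mul_of_nonneg_right (norm_toL2_le hφ hc) (norm_nonneg _))

end L2

/-! ### The integral operator, its semidiscretization and the two approximation estimates -/

namespace KernelBound

variable {κ : ℝ → ℝ → ℝ} {C : ℝ}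

lemma nonneg (h : KernelBound κ C) : 0 ≤ C :=
  (abs_nonneg _).trans (h.abs_le 0 (by simp) 0 (by simp))

lemma continuousOn_right (h : KernelBound κ C) {x : ℝ} (hx : x ∈ Set.Icc (0 : ℝ) 1) :
    ContinuousOn (κ x) (Set.Icc 0 1) := (h.snd x hx).continuousOn

lemma opK_eq_inner (h : KernelBound κ C) {x : ℝ} (hx : x ∈ Set.Icc (0 : ℝ) 1) (f : L2) :
    opK κ f x = ⟪toL2 (κ x) (h.continuousOn_right hx), f⟫ := (inner_toL2 _ f).symm

lemma norm_slice_le (h : KernelBound κ C) {x : ℝ} (hx : x ∈ Set.Icc (0 : ℝ) 1) :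
    ‖toL2 (κ x) (h.continuousOn_right hx)‖ ≤ C := norm_toL2_le _ (h.abs_le x hx)

/-- The Taylor expansion of the kernel in `x` is integrated against `f`. Since the expansion is an
inequality, no differentiation under the integral sign is involved. -/
lemma taylorBound_opK (h : KernelBound κ C) (f : L2) : TaylorBound (opK κ f) (C * ‖f‖) := by
  obtain ⟨G, hG, hGt⟩ := h.fst
  refine ⟨fun t ht => abs_integral_mul_le (h.continuousOn_right ht) (h.abs_le t ht) f,
    fun ξ hξ => ?_⟩
  have hGξ : ContinuousOn (fun y => G (ξ, y)) (Set.Icc 0 1) :=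
    hG.comp (by fun_prop) fun y hy => Set.mk_mem_prod hξ hy
  refine ⟨∫ y, G (ξ, y) * f y ∂unitMeasure,
    abs_integral_mul_le hGξ (fun y hy => (hGt y hy ξ hξ).1) f, fun t ht => ?_⟩
  have hcont : ContinuousOn (fun y => κ t y - κ ξ y - G (ξ, y) * (t - ξ)) (Set.Icc 0 1) :=
    ((h.continuousOn_right ht).sub (h.continuousOn_right hξ)).sub (hGξ.mul continuousOn_const)
  have heq : opK κ f t - opK κ f ξ - (∫ y, G (ξ, y) * f y ∂unitMeasure) * (t - ξ) =
      ∫ y, (κ t y - κ ξ y - G (ξ, y) * (t - ξ)) * f y ∂unitMeasure := by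
    unfold opK
    rw [← integral_sub (integrable_mul_L2 (h.continuousOn_right ht) f)
      (integrable_mul_L2 (h.continuousOn_right hξ) f), ← integral_mul_const, ← integral_sub]
    · exact integral_congr_ae (Filter.Eventually.of_forall fun y => by ring)
    · exact (integrable_mul_L2 (h.continuousOn_right ht) f).sub
        (integrable_mul_L2 (h.continuousOn_right hξ) f)
    · exact (integrable_mul_L2 hGξ f).mul_const _
  rw [heq]
  refine (abs_integral_mul_le hcont (fun y hy => (hGt y hy ξ hξ).2 t ht) f).trans (le_of_eq ?_)
  ring

/-- The integral operator on `L²(0,1)`. -/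
noncomputable def intOp (h : KernelBound κ C) : L2 →L[ℝ] L2 :=
  LinearMap.mkContinuous
    { toFun := fun f => toL2 (opK κ f) (h.taylorBound_opK f).continuousOn
      map_add' := fun f g => by
        refine Lp.ext ?_
        filter_upwards [coeFn_toL2 (h.taylorBound_opK (f + g)).continuousOn,
          coeFn_toL2 (h.taylorBound_opK f).continuousOn,
          coeFn_toL2 (h.taylorBound_opK g).continuousOn,
          Lp.coeFn_add (toL2 (opK κ f) (h.taylorBound_opK f).continuousOn)
            (toL2 (opK κ g) (h.taylorBound_opK g).continuousOn),
          ae_unitMeasure (p := fun t => t ∈ Set.Icc (0 : ℝ) 1) fun t ht => ht] with t h1 h2 h3 h4 ht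
        rw [h1, h4, Pi.add_apply, h2, h3, h.opK_eq_inner ht, h.opK_eq_inner ht, h.opK_eq_inner ht,
          inner_add_right]
      map_smul' := fun c f => by
        refine Lp.ext ?_
        filter_upwards [coeFn_toL2 (h.taylorBound_opK (c • f)).continuousOn,
          coeFn_toL2 (h.taylorBound_opK f).continuousOn,
          Lp.coeFn_smul c (toL2 (opK κ f) (h.taylorBound_opK f).continuousOn),
          ae_unitMeasure (p := fun t => t ∈ Set.Icc (0 : ℝ) 1) fun t ht => ht] with t h1 h2 h4 ht
        rw [h1, RingHom.id_apply, h4, Pi.smul_apply, h2, h.opK_eq_inner ht, h.opK_eq_inner ht,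
          inner_smul_right, smul_eq_mul] }
    C fun f => norm_toL2_le (h.taylorBound_opK f).continuousOn (h.taylorBound_opK f).1

lemma intOp_apply (h : KernelBound κ C) (f : L2) :
    h.intOp f = toL2 (opK κ f) (h.taylorBound_opK f).continuousOn := rfl

lemma norm_semiDiscrete_le (h : KernelBound κ C) (m : ℕ) (f : L2) :
    ‖semiDiscrete κ m f‖ ≤ C * ‖f‖ := by
  have hC := h.nonneg
  refine abs_le_of_sq_le_sq' ?_ (by positivity) |>.2
  rw [EuclideanSpace.norm_sq_eq]
  have hl : ∀ l : Fin m, ‖(semiDiscrete κ m f).ofLp l‖ ^ 2 ≤ 1 / (m : ℝ) * (C * ‖f‖) ^ 2 := by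
    intro l
    simp only [semiDiscrete, norm_mul, mul_pow, Real.norm_eq_abs, sq_abs, div_pow, one_pow]
    rw [Real.sq_sqrt (Nat.cast_nonneg m), ← mul_pow, ← sq_abs (opK _ _ _)]
    gcongr
    exact (h.taylorBound_opK f).1 _ (grid_mem m l)
  refine (Finset.sum_le_sum fun l _ => hl l).trans ?_
  rw [Finset.sum_const, Finset.card_univ, Fintype.card_fin, nsmul_eq_mul, ← mul_assoc]
  refine mul_le_of_le_one_left (sq_nonneg _) ?_
  rw [mul_one_div]
  exact div_self_le_one _

/-- The semidiscrete operator as a continuous linear map. -/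
noncomputable def semiOp (h : KernelBound κ C) (m : ℕ) : L2 →L[ℝ] EuclideanSpace ℝ (Fin m) :=
  LinearMap.mkContinuous
    { toFun := semiDiscrete κ m
      map_add' := fun f g => by
        ext l
        simp only [semiDiscrete, PiLp.add_apply]
        rw [h.opK_eq_inner (grid_mem m l), h.opK_eq_inner (grid_mem m l),
          h.opK_eq_inner (grid_mem m l), inner_add_right, mul_add]
      map_smul' := fun c f => by
        ext l
        simp only [semiDiscrete, PiLp.smul_apply, RingHom.id_apply, smul_eq_mul]
        rw [h.opK_eq_inner (grid_mem m l), h.opK_eq_inner (grid_mem m l), inner_smul_right]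
        ring }
    C (h.norm_semiDiscrete_le m)

lemma semiOp_apply (h : KernelBound κ C) (m : ℕ) (f : L2) :
    h.semiOp m f = semiDiscrete κ m f := rfl

end KernelBound

/-- The adjoint of the semidiscrete operator, as a pointwise defined function. -/
noncomputable def semiAdj (κ : ℝ → ℝ → ℝ) (m : ℕ) (u : EuclideanSpace ℝ (Fin m)) (y : ℝ) : ℝ :=
  1 / √m * ∑ l, u l * κ (grid m l) y

lemma TaylorBound.sum {ι : Type*} [Fintype ι] {a : ι → ℝ → ℝ} {A : ℝ}
    (h : ∀ i, TaylorBound (a i) A) (c : ι → ℝ) :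
    TaylorBound (fun t => ∑ i, c i * a i t) ((∑ i, |c i|) * A) := by
  have aux : ∀ (b : ι → ℝ) (r : ℝ), (∀ i, |b i| ≤ r) → |∑ i, c i * b i| ≤ (∑ i, |c i|) * r := by
    intro b r hb
    rw [Finset.sum_mul]
    refine (Finset.abs_sum_le_sum_abs _ _).trans (Finset.sum_le_sum fun i _ => ?_)
    rw [abs_mul]
    exact mul_le_mul_of_nonneg_left (hb i) (abs_nonneg _)
  refine ⟨fun t ht => aux _ _ fun i => (h i).1 t ht, fun ξ hξ => ?_⟩
  choose d hd hdt using fun i => (h i).2 ξ hξ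
  refine ⟨∑ i, c i * d i, aux _ _ hd, fun t ht => ?_⟩
  have := aux _ _ fun i => hdt i t ht
  have heq : ∑ i, c i * a i t - ∑ i, c i * a i ξ - (∑ i, c i * d i) * (t - ξ) =
      ∑ i, c i * (a i t - a i ξ - d i * (t - ξ)) := by
    rw [Finset.sum_mul, ← Finset.sum_sub_distrib, ← Finset.sum_sub_distrib]
    exact Finset.sum_congr rfl fun i _ => by ring
  rw [heq, mul_assoc]
  exact this

lemma TaylorBound.const_mul {a : ℝ → ℝ} {A : ℝ} (h : TaylorBound a A) {c : ℝ} (hc : 0 ≤ c) :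
    TaylorBound (fun t => c * a t) (c * A) := by
  simpa [abs_of_nonneg hc] using TaylorBound.sum (ι := Unit) (fun _ => h) (fun _ => c)

lemma TaylorBound.mono {a : ℝ → ℝ} {A B : ℝ} (h : TaylorBound a A) (hAB : A ≤ B) :
    TaylorBound a B :=
  ⟨fun t ht => (h.1 t ht).trans hAB, fun ξ hξ => by
    obtain ⟨d, hd, hdt⟩ := h.2 ξ hξ
    exact ⟨d, hd.trans hAB, fun t ht =>
      (hdt t ht).trans (mul_le_mul_of_nonneg_right hAB (sq_nonneg _))⟩⟩

namespace KernelBound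

variable {κ : ℝ → ℝ → ℝ} {C : ℝ}

lemma taylorBound_semiAdj (h : KernelBound κ C) {m : ℕ} (u : EuclideanSpace ℝ (Fin m)) :
    TaylorBound (semiAdj κ m u) (C * ‖u‖) := by
  have hC := h.nonneg
  refine ((TaylorBound.sum (fun l => h.snd _ (grid_mem m l)) fun l => u l).const_mul
    (by positivity : 0 ≤ 1 / √(m : ℝ))).mono ?_
  -- Cauchy–Schwarz: the factor `√m` cancels the normalization `1 / √m` of `semiAdj`.
  have h1 : ∑ l, |u l| ≤ √m * ‖u‖ := by
    refine abs_le_of_sq_le_sq' ?_ (by positivity) |>.2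
    rw [mul_pow, Real.sq_sqrt (Nat.cast_nonneg m), EuclideanSpace.norm_sq_eq]
    simpa using sq_sum_le_card_mul_sum_sq (s := Finset.univ) (f := fun l => |u l|)
  rcases Nat.eq_zero_or_pos m with rfl | hm
  · simp only [Nat.cast_zero, Real.sqrt_zero, div_zero, zero_mul]
    positivity
  · have hs : 0 < √(m : ℝ) := Real.sqrt_pos.2 (by exact_mod_cast hm)
    calc 1 / √(m : ℝ) * ((∑ l, |u l|) * C) ≤ 1 / √(m : ℝ) * ((√m * ‖u‖) * C) := by gcongr
      _ = C * ‖u‖ := by field_simp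

lemma adjoint_semiOp (h : KernelBound κ C) {m : ℕ} (u : EuclideanSpace ℝ (Fin m)) :
    (h.semiOp m).adjoint u = toL2 (semiAdj κ m u) (h.taylorBound_semiAdj u).continuousOn := by
  refine ext_inner_right ℝ fun f => ?_
  rw [ContinuousLinearMap.adjoint_inner_left, inner_toL2, h.semiOp_apply, PiLp.inner_apply]
  have : ∀ y, semiAdj κ m u y * f y = ∑ l, 1 / √m * u l * (κ (grid m l) y * f y) := fun y => by
    rw [semiAdj, Finset.mul_sum, Finset.sum_mul]
    exact Finset.sum_congr rfl fun l _ => by ring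
  simp only [this]
  rw [integral_finsetSum _ fun l _ =>
    (integrable_mul_L2 (h.continuousOn_right (grid_mem m l)) f).const_mul _]
  refine Finset.sum_congr rfl fun l _ => ?_
  rw [integral_const_mul]
  simp only [semiDiscrete, opK, RCLike.inner_apply, conj_trivial]
  ring

/-- The inner product of the semidiscrete images is the midpoint sum for the integral of `(K x)(K
y)`. -/
lemma form_close (h : KernelBound κ C) {m : ℕ} (hm : 1 ≤ m) (x y : L2) :
    |⟪h.intOp x, h.intOp y⟫ - ⟪h.semiOp m x, h.semiOp m y⟫| ≤ C ^ 2 / m ^ 2 * ‖x‖ * ‖y‖ := by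
  have h1 := abs_midpoint_le (h.taylorBound_opK x) (h.taylorBound_opK y) hm
  have h2 : ⟪h.semiOp m x, h.semiOp m y⟫ =
      1 / (m : ℝ) * ∑ l, opK κ x (grid m l) * opK κ y (grid m l) := by
    rw [h.semiOp_apply, h.semiOp_apply, PiLp.inner_apply, Finset.mul_sum]
    refine Finset.sum_congr rfl fun l _ => ?_
    simp only [semiDiscrete, RCLike.inner_apply, conj_trivial]
    have : 1 / √(m : ℝ) * (1 / √m) = 1 / m := by
      rw [div_mul_div_comm, one_mul, Real.mul_self_sqrt (Nat.cast_nonneg m)]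
    rw [← this]
    ring
  rw [h.intOp_apply, h.intOp_apply, inner_toL2_toL2, h2]
  refine h1.trans (le_of_eq ?_)
  ring

/-- The midpoint rule in the other variable: at the nodes, `L† u` takes the values of `√m Aᵀ u`, so
the midpoint sum for `⟪L† u, L† u'⟫` is the form of `A Aᵀ`. -/
lemma adjoint_close (h : KernelBound κ C) {m : ℕ} (hm : 1 ≤ m)
    (u u' : EuclideanSpace ℝ (Fin m)) :
    |⟪(h.semiOp m).adjoint u, (h.semiOp m).adjoint u'⟫ -
      ∑ i, ((quadMatrix κ m).transpose.mulVec u.ofLp) i *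
        ((quadMatrix κ m).transpose.mulVec u'.ofLp) i| ≤
      C ^ 2 / m ^ 2 * ‖u‖ * ‖u'‖ := by
  have hm0 : (0 : ℝ) < m := by exact_mod_cast hm
  have h1 := abs_midpoint_le (h.taylorBound_semiAdj u) (h.taylorBound_semiAdj u') hm
  have h2 : ∀ (u : EuclideanSpace ℝ (Fin m)) (i : Fin m), semiAdj κ m u (grid m i) =
      √m * ((quadMatrix κ m).transpose.mulVec u.ofLp) i := by
    intro u i
    simp only [semiAdj, quadMatrix, Matrix.mulVec, dotProduct, Matrix.transpose_apply,
      Matrix.of_apply]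
    rw [Finset.mul_sum, Finset.mul_sum]
    refine Finset.sum_congr rfl fun l _ => ?_
    have : 1 / √(m : ℝ) = √m * (1 / m) := by
      have hs : √(m : ℝ) ≠ 0 := (Real.sqrt_pos.2 hm0).ne'
      field_simp
      exact (Real.sq_sqrt hm0.le).symm
    rw [this]
    ring
  rw [h.adjoint_semiOp, h.adjoint_semiOp, inner_toL2_toL2]
  have h3 : 1 / (m : ℝ) * ∑ l, semiAdj κ m u (grid m l) * semiAdj κ m u' (grid m l) =
      ∑ i, ((quadMatrix κ m).transpose.mulVec u.ofLp) i *
        ((quadMatrix κ m).transpose.mulVec u'.ofLp) i := by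
    rw [Finset.mul_sum]
    refine Finset.sum_congr rfl fun i _ => ?_
    rw [h2, h2]
    calc _ = 1 / (m : ℝ) * (√m * √m) * (((quadMatrix κ m).transpose.mulVec u.ofLp) i *
        ((quadMatrix κ m).transpose.mulVec u'.ofLp) i) := by ring
      _ = _ := by rw [Real.mul_self_sqrt hm0.le, one_div_mul_cancel hm0.ne', one_mul]
  rw [h3] at h1
  refine h1.trans (le_of_eq ?_)
  ring

lemma inner_intOp_intOp (h : KernelBound κ C) (x y : L2) :
    ⟪h.intOp x, h.intOp y⟫ = ∫ s, opKadj κ (opK κ x) s * y s ∂unitMeasure := by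
  rw [h.intOp_apply, h.intOp_apply, inner_toL2_toL2]
  have hint : Integrable (Function.uncurry fun t s => opK κ x t * (κ t s * y s))
      (unitMeasure.prod unitMeasure) := by
    have h1 : Integrable (fun z : ℝ × ℝ => opK κ x z.1 * y z.2) (unitMeasure.prod unitMeasure) :=
      ((memLp_of_continuousOn (h.taylorBound_opK x).continuousOn).integrable
        (by norm_num)).mul_prod (integrable_L2 y)
    have hprod : unitMeasure.prod unitMeasure =
        (volume : Measure (ℝ × ℝ)).restrict (Set.Ioo 0 1 ×ˢ Set.Ioo 0 1) := by
      rw [Measure.prod_restrict, Measure.volume_eq_prod]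
    have hmeas : MeasurableSet (Set.Ioo (0 : ℝ) 1 ×ˢ Set.Ioo (0 : ℝ) 1) :=
      measurableSet_Ioo.prod measurableSet_Ioo
    have hsub : Set.Ioo (0 : ℝ) 1 ×ˢ Set.Ioo (0 : ℝ) 1 ⊆ unitSq :=
      Set.prod_mono Set.Ioo_subset_Icc_self Set.Ioo_subset_Icc_self
    have h2 := h1.bdd_mul (f := fun z : ℝ × ℝ => κ z.1 z.2) (c := C)
      (by
        rw [hprod]
        exact (h.continuousOn.mono hsub).aestronglyMeasurable hmeas)
      (by
        rw [hprod]
        refine (ae_restrict_iff' hmeas).2 (Filter.Eventually.of_forall fun z hz => ?_)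
        exact h.abs_le _ (hsub hz).1 _ (hsub hz).2)
    refine h2.congr (Filter.Eventually.of_forall fun z => ?_)
    simp only [Function.uncurry]
    ring
  have hswap := integral_integral_swap hint
  simp only [integral_const_mul] at hswap
  unfold opKadj
  refine hswap.trans (integral_congr_ae (Filter.Eventually.of_forall fun s => ?_))
  change ∫ t, opK κ x t * (κ t s * y s) ∂unitMeasure =
    (∫ t, κ t s * opK κ x t ∂unitMeasure) * y s
  rw [← integral_mul_const]
  exact integral_congr_ae (Filter.Eventually.of_forall fun t => by ring)

/-- Hilbert–Schmidt bound: for fixed `t`, Bessel's inequality for the slice `κ t` controls the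
integrand. It supplies the decay that makes multiplicities of nonzero singular values finite. -/
lemma sum_norm_sq_intOp_le (h : KernelBound κ C) {e : ℕ → L2} (he : Orthonormal ℝ e) (N : ℕ) :
    ∑ j ∈ Finset.range N, ‖h.intOp (e j)‖ ^ 2 ≤ C ^ 2 := by
  have h1 : ∀ j, ‖h.intOp (e j)‖ ^ 2 = ∫ t, opK κ (e j) t * opK κ (e j) t ∂unitMeasure :=
    fun j => by rw [← real_inner_self_eq_norm_sq, h.intOp_apply, inner_toL2_toL2]
  have hm : ∀ j, MemLp (opK κ (e j)) 2 unitMeasure := fun j =>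
    memLp_of_continuousOn (h.taylorBound_opK _).continuousOn
  have hi : ∀ j, Integrable (fun t => opK κ (e j) t * opK κ (e j) t) unitMeasure := fun j =>
    (hm j).integrable_mul (hm j)
  simp only [h1]
  rw [← integral_finsetSum _ fun j _ => hi j]
  have h2 : ∀ᵐ t ∂unitMeasure,
      ‖∑ j ∈ Finset.range N, opK κ (e j) t * opK κ (e j) t‖ ≤ C ^ 2 := by
    refine ae_unitMeasure fun t ht => ?_
    rw [Real.norm_eq_abs, abs_of_nonneg (Finset.sum_nonneg fun j _ => mul_self_nonneg _)]
    calc ∑ j ∈ Finset.range N, opK κ (e j) t * opK κ (e j) t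
        = ∑ j ∈ Finset.range N, ⟪e j, toL2 (κ t) (h.continuousOn_right ht)⟫ ^ 2 :=
          Finset.sum_congr rfl fun j _ => by rw [h.opK_eq_inner ht, real_inner_comm]; ring
      _ ≤ ‖toL2 (κ t) (h.continuousOn_right ht)‖ ^ 2 := sum_sq_inner_le he _ _
      _ ≤ C ^ 2 := by
          have := h.norm_slice_le ht
          gcongr
  have := norm_integral_le_of_norm_le_const h2
  rw [measureReal_unitMeasure, mul_one] at this
  exact (le_abs_self _).trans this

end KernelBound

/-! ### Singular value decompositions as an abstract discretization -/

section Discretization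

variable {κ : ℝ → ℝ → ℝ} {C : ℝ} {m : ℕ} {σ : ℕ → ℝ} {v : ℕ → L2}
  {z w : ℕ → EuclideanSpace ℝ (Fin m)} {s : ℕ → ℝ}

/-- The orthonormal basis given by an orthonormal family of full cardinality. -/
noncomputable def basisOfFin {b : Fin m → EuclideanSpace ℝ (Fin m)} (hb : Orthonormal ℝ b) :
    OrthonormalBasis (Fin m) ℝ (EuclideanSpace ℝ (Fin m)) :=
  OrthonormalBasis.mk hb
    (hb.linearIndependent.span_eq_top_of_card_eq_finrank' (by simp)).ge

lemma basisOfFin_apply {b : Fin m → EuclideanSpace ℝ (Fin m)} (hb : Orthonormal ℝ b) (i : Fin m) :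
    basisOfFin hb i = b i := by simp [basisOfFin]

/-- Parseval in the basis `z`, whose coefficients are `⟪z j, Aᵀ u⟫ = ⟪A (z j), u⟫ = s j * ⟪w j, u⟫`.
-/
lemma IsMatrixSVD.sum_transpose_mul {A : Matrix (Fin m) (Fin m) ℝ} (hA : IsMatrixSVD A z w s)
    (u u' : EuclideanSpace ℝ (Fin m)) :
    ∑ i, (A.transpose.mulVec u.ofLp) i * (A.transpose.mulVec u'.ofLp) i =
      ∑ j : Fin m, s (j + 1) ^ 2 * ⟪w (j + 1), u⟫ * ⟪w (j + 1), u'⟫ := by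
  set b := basisOfFin hA.orthonormal_right
  let y : EuclideanSpace ℝ (Fin m) → EuclideanSpace ℝ (Fin m) :=
    fun u => WithLp.toLp 2 (A.transpose.mulVec u.ofLp)
  have hz : ∀ (j : Fin m) (u : EuclideanSpace ℝ (Fin m)), ⟪b j, y u⟫ = s (j + 1) * ⟪w (j + 1), u⟫ := by
    intro j u
    have h1 : ⟪b j, y u⟫ = dotProduct (z (j + 1)).ofLp (A.transpose.mulVec u.ofLp) := by
      rw [basisOfFin_apply, PiLp.inner_apply, dotProduct]
      exact Finset.sum_congr rfl fun i _ => by simp [y, mul_comm]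
    rw [h1, Matrix.dotProduct_mulVec, Matrix.vecMul_transpose, dotProduct, PiLp.inner_apply,
      Finset.mul_sum]
    refine Finset.sum_congr rfl fun i _ => ?_
    have := hA.mul_right (j + 1) (by omega) j.2 i
    rw [show A.mulVec (z (j + 1)).ofLp i = s (j + 1) * w (j + 1) i from this]
    simp only [RCLike.inner_apply, conj_trivial]
    ring
  have h2 : ∑ i, (A.transpose.mulVec u.ofLp) i * (A.transpose.mulVec u'.ofLp) i = ⟪y u, y u'⟫ := by
    rw [PiLp.inner_apply]
    exact Finset.sum_congr rfl fun i _ => by simp [y, mul_comm]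
  rw [h2, ← b.sum_inner_mul_inner]
  refine Finset.sum_congr rfl fun j _ => ?_
  rw [real_inner_comm, hz, hz]
  ring

lemma isDiscretization (h : KernelBound κ C) (hm : 1 ≤ m) (hK : IsSingularSystem κ σ v)
    (hA : IsMatrixSVD (quadMatrix κ m) z w s) :
    IsDiscretization h.intOp (h.semiOp m) (fun j => v (j + 1)) (fun j => σ (j + 1) ^ 2)
      (basisOfFin hA.orthonormal_left) (fun j => s (j + 1) ^ 2) (C ^ 2 / m ^ 2) where
  lam_antitone i j hij := pow_le_pow_left₀ (hK.nonneg _ (by omega))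
    (hK.antitone _ _ (by omega) (by omega)) 2
  mu_antitone i j hij := pow_le_pow_left₀ (hA.nonneg _ (by omega) j.2)
    (hA.antitone _ _ (by omega) (by simpa using hij) j.2) 2
  mu_nonneg j := sq_nonneg _
  eta_nonneg := by positivity
  orthonormal := hK.orthonormal
  eigen j y := by
    rw [h.inner_intOp_intOp, inner_L2, ← integral_const_mul]
    refine integral_congr_ae ?_
    filter_upwards [hK.eigen (j + 1) (by omega)] with t ht
    rw [ht, mul_assoc]
  complete g hg := by
    have h0 := hK.complete g fun j hj => by simpa [Nat.sub_add_cancel hj] using hg (j - 1)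
    rw [h.intOp_apply]
    refine Lp.ext ?_
    filter_upwards [coeFn_toL2 (h.taylorBound_opK g).continuousOn, h0,
      Lp.coeFn_zero ℝ 2 unitMeasure] with t h1 h2 h3
    rw [h1, h2, h3]
  form_close := h.form_close hm
  adjoint_close u u' := by
    have := h.adjoint_close hm u u'
    rw [hA.sum_transpose_mul] at this
    simpa only [basisOfFin_apply] using this

end Discretization

/-! ### Spectral gaps, multiplicities and admissible indices -/

section Gaps

/-- A nonnegative sequence, non-increasing from index `1` on, whose squares are summable with
sum at most `C²`. -/
structure IsSingularSequence (σ : ℕ → ℝ) (C : ℝ) : Prop where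
  nonneg : ∀ j, 1 ≤ j → 0 ≤ σ j
  antitone : ∀ i j, 1 ≤ i → i ≤ j → σ j ≤ σ i
  mul_sq_le : ∀ j, 1 ≤ j → j * σ j ^ 2 ≤ C ^ 2

variable {σ : ℕ → ℝ} {C : ℝ} {j : ℕ}

/-- A positive value cannot repeat beyond `C ^ 2 / σ j ^ 2`, so the supremum defining `psiPlus` is
attained and is not the default value `0`. -/
lemma IsSingularSequence.bddAbove (h : IsSingularSequence σ C) (hj : 0 < σ j) :
    BddAbove {i : ℕ | 1 ≤ i ∧ σ i = σ j} := by
  refine ⟨⌈C ^ 2 / σ j ^ 2⌉₊, fun i hi => ?_⟩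
  have h1 := h.mul_sq_le i hi.1
  rw [hi.2, ← le_div_iff₀ (by positivity)] at h1
  exact_mod_cast h1.trans (Nat.le_ceil _)

lemma IsSingularSequence.le_bound (h : IsSingularSequence σ C) (hC : 0 ≤ C) (hj : 1 ≤ j) :
    σ j ≤ C := by
  refine abs_le_of_sq_le_sq' ?_ hC |>.2
  have h1 := h.mul_sq_le j hj
  have h2 : (1 : ℝ) ≤ j := by exact_mod_cast hj
  nlinarith [sq_nonneg (σ j)]

lemma psiMinus_mem (σ : ℕ → ℝ) (hj : 1 ≤ j) :
    1 ≤ psiMinus σ j ∧ σ (psiMinus σ j) = σ j :=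
  Nat.sInf_mem (s := {i : ℕ | 1 ≤ i ∧ σ i = σ j}) ⟨j, hj, rfl⟩

lemma psiMinus_le (σ : ℕ → ℝ) (hj : 1 ≤ j) : psiMinus σ j ≤ j := Nat.sInf_le ⟨hj, rfl⟩

lemma IsSingularSequence.lt_of_lt_psiMinus (h : IsSingularSequence σ C) (hj : 1 ≤ j) {i : ℕ}
    (hi : 1 ≤ i) (hij : i < psiMinus σ j) : σ j < σ i := by
  refine lt_of_le_of_ne (h.antitone i j hi (hij.le.trans (psiMinus_le σ hj))) fun heq => ?_
  exact absurd (Nat.sInf_le (s := {i : ℕ | 1 ≤ i ∧ σ i = σ j}) ⟨hi, heq.symm⟩) (not_le.2 hij)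

lemma IsSingularSequence.psiPlus_mem (h : IsSingularSequence σ C) (hj : 1 ≤ j) (hpos : 0 < σ j) :
    1 ≤ psiPlus σ j ∧ σ (psiPlus σ j) = σ j :=
  Nat.sSup_mem (s := {i : ℕ | 1 ≤ i ∧ σ i = σ j}) ⟨j, hj, rfl⟩ (h.bddAbove hpos)

lemma IsSingularSequence.le_psiPlus (h : IsSingularSequence σ C) (hj : 1 ≤ j) (hpos : 0 < σ j) :
    j ≤ psiPlus σ j := le_csSup (h.bddAbove hpos) ⟨hj, rfl⟩

lemma IsSingularSequence.psiPlus_succ_lt (h : IsSingularSequence σ C) (hj : 1 ≤ j)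
    (hpos : 0 < σ j) : σ (psiPlus σ j + 1) < σ j := by
  have h1 := h.psiPlus_mem hj hpos
  refine lt_of_le_of_ne (h1.2 ▸ h.antitone _ _ h1.1 (Nat.le_succ _)) fun heq => ?_
  have : psiPlus σ j + 1 ≤ psiPlus σ j := le_csSup (h.bddAbove hpos) ⟨by omega, heq⟩
  omega

lemma gap_le_right (σ : ℕ → ℝ) (j : ℕ) :
    gap σ j ≤ σ (psiPlus σ j) ^ 2 - σ (psiPlus σ j + 1) ^ 2 := by
  unfold gap
  split_ifs
  · exact le_rfl
  · exact min_le_left _ _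

lemma IsSingularSequence.gap_le_sq (h : IsSingularSequence σ C) (hj : 1 ≤ j) (hpos : 0 < σ j) :
    gap σ j ≤ σ j ^ 2 := by
  have h1 := gap_le_right σ j
  rw [(h.psiPlus_mem hj hpos).2] at h1
  nlinarith [sq_nonneg (σ (psiPlus σ j + 1))]

lemma IsSingularSequence.gap_pos (h : IsSingularSequence σ C) (hj : 1 ≤ j) (hpos : 0 < σ j) :
    0 < gap σ j := by
  have h1 : 0 < σ (psiPlus σ j) ^ 2 - σ (psiPlus σ j + 1) ^ 2 := by
    rw [(h.psiPlus_mem hj hpos).2, sub_pos]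
    exact pow_lt_pow_left₀ (h.psiPlus_succ_lt hj hpos) (h.nonneg _ (by omega)) (by norm_num)
  have hm := psiMinus_mem σ hj
  unfold gap
  split_ifs with h2
  · exact h1
  · refine lt_min h1 ?_
    rw [hm.2, sub_pos]
    exact pow_lt_pow_left₀ (h.lt_of_lt_psiMinus hj (by omega) (by omega)) hpos.le (by norm_num)

lemma IsSingularSequence.add_gap_le (h : IsSingularSequence σ C) (hj : 1 ≤ j)
    {i : ℕ} (hi : 1 ≤ i) (hij : i < psiMinus σ j) :
    σ j ^ 2 + gap σ j ≤ σ i ^ 2 := by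
  have hm := psiMinus_mem σ hj
  have h1 : gap σ j ≤ σ (psiMinus σ j - 1) ^ 2 - σ j ^ 2 := by
    unfold gap
    rw [if_neg (by omega), hm.2]
    exact min_le_right _ _
  have h2 : σ (psiMinus σ j - 1) ^ 2 ≤ σ i ^ 2 :=
    pow_le_pow_left₀ (h.nonneg _ (by omega)) (h.antitone _ _ hi (by omega)) 2
  linarith

lemma one_le_maxMult (σ : ℕ → ℝ) (i : ℕ) : (1 : ℝ) ≤ maxMult σ i := by
  have : 1 ≤ maxMult σ i := Nat.le_add_right _ _
  exact_mod_cast this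

/-- The second entry of the maximum in `Admissible`, with `maxMult σ j ≥ 1` and `σ j ≤ C`, already
gives the smallness of `η = C ^ 2 / m ^ 2` that the perturbation theory requires. -/
lemma IsSingularSequence.ten_mul_le_gap (h : IsSingularSequence σ C) (hC : 0 ≤ C) {m : ℕ}
    (hm : 1 ≤ m) (hj : 1 ≤ j) (hadm : Admissible C σ m j) :
    10 * (C ^ 2 / m ^ 2) ≤ gap σ j := by
  obtain ⟨hpos, hlt⟩ := hadm
  have hm0 : (0 : ℝ) < m := by exact_mod_cast hm
  have hg := h.gap_pos hj hpos
  have hM := one_le_maxMult σ j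
  have hσC := h.le_bound hC hj
  have h1 := (max_lt_iff.1 hlt).2
  rw [div_lt_one (by positivity)] at h1
  have h2 : 10 * C ^ 2 * σ j ≤ gap σ j * m ^ 2 * σ j :=
    calc 10 * C ^ 2 * σ j ≤ 10 * C ^ 2 * C := by gcongr
      _ = 10 * 1 * C ^ 3 := by ring
      _ ≤ 10 * maxMult σ j * C ^ 3 := by gcongr
      _ ≤ gap σ j * σ j * m ^ 2 := h1.le
      _ = _ := by ring
  rw [← mul_div_assoc, div_le_iff₀ (by positivity)]
  exact le_of_mul_le_mul_right h2 hpos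

/-- The supremum of an empty or unbounded set of naturals is `0`, so `1 ≤ k ≤ maxLevel C σ m`
excludes both cases and the maximum is attained. -/
lemma admissible_of_le_maxLevel {m k : ℕ} (hk1 : 1 ≤ k) (hk : k ≤ maxLevel C σ m) {i : ℕ}
    (hi : 1 ≤ i) (hik : i ≤ k) : Admissible C σ m i := by
  set S := {j : ℕ | 1 ≤ j ∧ ∀ i, 1 ≤ i → i ≤ j → Admissible C σ m i} with hS
  have hpos : sSup S ≠ 0 := by
    have : 1 ≤ sSup S := hk1.trans hk
    omega
  have hbdd : BddAbove S := by
    by_contra hb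
    exact hpos (Nat.sSup_of_not_bddAbove hb)
  have hne : S.Nonempty := by
    rw [Set.nonempty_iff_ne_empty]
    intro he
    exact hpos (by rw [he]; simp)
  exact (Nat.sSup_mem hne hbdd).2 i hi (hik.trans hk)

lemma KernelBound.isSingularSequence {κ : ℝ → ℝ → ℝ} {v : ℕ → L2} {m : ℕ} (h : KernelBound κ C)
    {w : OrthonormalBasis (Fin m) ℝ (EuclideanSpace ℝ (Fin m))} {mu : Fin m → ℝ} {η : ℝ}
    (hK : IsSingularSystem κ σ v)
    (hD : IsDiscretization h.intOp (h.semiOp m) (fun j => v (j + 1)) (fun j => σ (j + 1) ^ 2)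
      w mu η) : IsSingularSequence σ C where
  nonneg := hK.nonneg
  antitone := hK.antitone
  mul_sq_le N hN := by
    refine le_trans ?_ (h.sum_norm_sq_intOp_le hK.orthonormal N)
    calc (N : ℝ) * σ N ^ 2 = ∑ _j ∈ Finset.range N, σ N ^ 2 := by simp
      _ ≤ ∑ j ∈ Finset.range N, ‖h.intOp (v (j + 1))‖ ^ 2 := by
        refine Finset.sum_le_sum fun j hj => ?_
        rw [hD.norm_sq_eigen j]
        exact pow_le_pow_left₀ (hK.nonneg _ hN)
          (hK.antitone _ _ (by omega) (Finset.mem_range.1 hj)) 2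

end Gaps

/-! ### Second moments of the noise -/

section Noise

variable {H : Type*} [NormedAddCommGroup H] [InnerProductSpace ℝ H]
  {Ω : Type*} [MeasurableSpace Ω] {P : Measure Ω} [IsProbabilityMeasure P]
  {ι : Type*} [Fintype ι]

/-- Bias–variance decomposition with orthonormal noise coefficients. -/
lemma integral_norm_sq_add_noise [DecidableEq ι] {X : ι → Ω → ℝ} (hX : ∀ i, MemLp (X i) 2 P)
    (hmean : ∀ i, ∫ ω, X i ω ∂P = 0)
    (hcov : ∀ i j, ∫ ω, X i ω * X j ω ∂P = if i = j then 1 else 0) (b : H) (d : ι → H) :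
    Integrable (fun ω => ‖b + ∑ i, X i ω • d i‖ ^ 2) P ∧
      ∫ ω, ‖b + ∑ i, X i ω • d i‖ ^ 2 ∂P = ‖b‖ ^ 2 + ∑ i, ‖d i‖ ^ 2 := by
  have hexp : (fun ω => ‖b + ∑ i, X i ω • d i‖ ^ 2) = fun ω =>
      ‖b‖ ^ 2 + ∑ i, X i ω * (2 * ⟪b, d i⟫) + ∑ i, ∑ j, X i ω * X j ω * ⟪d i, d j⟫ := by
    funext ω
    rw [norm_add_sq_real, ← real_inner_self_eq_norm_sq (∑ i, X i ω • d i), inner_sum, sum_inner,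
      Finset.mul_sum]
    congr 1
    · congr 1
      exact Finset.sum_congr rfl fun i _ => by rw [inner_smul_right]; ring
    · refine Finset.sum_congr rfl fun i _ => ?_
      rw [inner_sum]
      refine Finset.sum_congr rfl fun j _ => ?_
      rw [inner_smul_right, real_inner_smul_left]
      ring
  have hi1 : ∀ i, Integrable (fun ω => X i ω * (2 * ⟪b, d i⟫)) P := fun i =>
    ((hX i).integrable (by norm_num)).mul_const _
  have hi2 : ∀ i j, Integrable (fun ω => X i ω * X j ω * ⟪d i, d j⟫) P := fun i j =>
    ((hX i).integrable_mul (hX j)).mul_const _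
  have hs1 : Integrable (fun ω => ∑ i, X i ω * (2 * ⟪b, d i⟫)) P :=
    integrable_finsetSum _ fun i _ => hi1 i
  have hs2' : ∀ i, Integrable (fun ω => ∑ j, X i ω * X j ω * ⟪d i, d j⟫) P := fun i =>
    integrable_finsetSum _ fun j _ => hi2 i j
  have hs2 : Integrable (fun ω => ∑ i, ∑ j, X i ω * X j ω * ⟪d i, d j⟫) P :=
    integrable_finsetSum _ fun i _ => hs2' i
  have hs0 : Integrable (fun ω => ‖b‖ ^ 2 + ∑ i, X i ω * (2 * ⟪b, d i⟫)) P :=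
    (integrable_const _).add hs1
  rw [hexp]
  refine ⟨hs0.add hs2, ?_⟩
  rw [integral_add hs0 hs2, integral_add (integrable_const _) hs1,
    integral_finsetSum _ fun i _ => hi1 i, integral_finsetSum _ fun i _ => hs2' i]
  simp only [integral_mul_const, hmean, integral_finsetSum _ fun j _ => hi2 _ j, hcov]
  simp

/-- An orthogonal change of basis preserves mean zero and identity covariance; independence enters
only through the vanishing of the mixed second moments. -/
lemma whiteNoise_coefficients {m : ℕ} {Z : Fin m → Ω → ℝ} (hZL2 : ∀ l, MemLp (Z l) 2 P)
    (hZindep : iIndepFun Z P) (hZmean : ∀ l, ∫ ω, Z l ω ∂P = 0)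
    (hZvar : ∀ l, ∫ ω, Z l ω ^ 2 ∂P = 1)
    (b : OrthonormalBasis (Fin m) ℝ (EuclideanSpace ℝ (Fin m))) :
    (∀ i, MemLp (fun ω => ⟪b i, WithLp.toLp 2 fun l => Z l ω⟫) 2 P) ∧
      (∀ i, ∫ ω, ⟪b i, WithLp.toLp 2 fun l => Z l ω⟫ ∂P = 0) ∧
      ∀ i j, ∫ ω, ⟪b i, WithLp.toLp 2 fun l => Z l ω⟫ * ⟪b j, WithLp.toLp 2 fun l => Z l ω⟫ ∂P =
        if i = j then 1 else 0 := by
  have hX : ∀ i ω, ⟪b i, WithLp.toLp 2 fun l => Z l ω⟫ = ∑ l, b i l * Z l ω := fun i ω => by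
    rw [PiLp.inner_apply]
    exact Finset.sum_congr rfl fun l _ => by simp [mul_comm]
  have hZZ : ∀ l l', ∫ ω, Z l ω * Z l' ω ∂P = if l = l' then 1 else 0 := by
    intro l l'
    split_ifs with hl
    · subst hl
      rw [← hZvar l]
      exact integral_congr_ae (Filter.Eventually.of_forall fun ω => (sq (Z l ω)).symm)
    · have := (hZindep.indepFun hl).integral_mul_eq_mul_integral
        (hZL2 l).aestronglyMeasurable (hZL2 l').aestronglyMeasurable
      rw [hZmean, zero_mul] at this
      exact this
  have hi : ∀ l l', Integrable (fun ω => Z l ω * Z l' ω) P := fun l l' =>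
    (hZL2 l).integrable_mul (hZL2 l')
  simp only [hX]
  refine ⟨fun i => memLp_finsetSum _ fun l _ => (hZL2 l).const_mul _, fun i => ?_, fun i j => ?_⟩
  · rw [integral_finsetSum _ fun l _ => ((hZL2 l).integrable (by norm_num)).const_mul _]
    simp [integral_const_mul, hZmean]
  · have hprod : ∀ ω, (∑ l, b i l * Z l ω) * ∑ l, b j l * Z l ω =
        ∑ l, ∑ l', b i l * b j l' * (Z l ω * Z l' ω) := fun ω => by
      rw [Finset.sum_mul_sum]
      exact Finset.sum_congr rfl fun l _ => Finset.sum_congr rfl fun l' _ => by ring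
    simp only [hprod]
    rw [integral_finsetSum _ fun l _ => integrable_finsetSum _ fun l' _ => (hi l l').const_mul _]
    simp only [integral_finsetSum _ fun l' _ => (hi _ l').const_mul _, integral_const_mul, hZZ]
    have hin : ⟪b i, b j⟫ = ∑ l, b i l * b j l := by
      rw [PiLp.inner_apply]
      exact Finset.sum_congr rfl fun l _ => by simp [mul_comm]
    rw [← orthonormal_iff_ite.1 b.orthonormal i j, hin]
    simp

end Noise

/-! ### The estimator as a truncated inverse, and its variance -/

section Estimator

lemma sum_fin_ite_eq {m k : ℕ} (hkm : k ≤ m) (F : ℕ → ℝ) :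
    ∑ j : Fin m, (if (j : ℕ) < k then F (j + 1) else 0) = ∑ j ∈ Finset.Icc 1 k, F j := by
  rw [Fin.sum_univ_eq_sum_range (fun j => if j < k then F (j + 1) else 0) m, ← Finset.sum_filter,
    show (Finset.range m).filter (· < k) = Finset.range k by ext i; simp; omega,
    ← Finset.Ico_add_one_right_eq_Icc, Finset.sum_Ico_eq_sum_range]
  simp [add_comm]

variable {κ : ℝ → ℝ → ℝ} {C : ℝ} {m : ℕ} {z w : ℕ → EuclideanSpace ℝ (Fin m)} {s : ℕ → ℝ}
  {A : Matrix (Fin m) (Fin m) ℝ}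

/-- The two factors `1 / s j`, from the coefficient and from the approximate singular function,
combine to the inverse eigenvalue of `A Aᵀ`. With `1 / 0 = 0` the identity needs no positivity. -/
lemma estimator_eq_semiAdj (hA : IsMatrixSVD A z w s) (n : Fin m)
    (g : EuclideanSpace ℝ (Fin m)) (y : ℝ) :
    estimator κ w s g (n + 1) y = semiAdj κ m (diagOp Finset.univ (basisOfFin hA.orthonormal_left)
      (truncInv (fun j : Fin m => s (j + 1) ^ 2) n) ((1 / √m : ℝ) • g)) y := by
  rw [estimator, ← sum_fin_ite_eq (m := m) (by omega)]
  have hS : ∀ l, (diagOp Finset.univ (basisOfFin hA.orthonormal_left)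
      (truncInv (fun j : Fin m => s (j + 1) ^ 2) n) ((1 / √m : ℝ) • g)) l =
      ∑ j : Fin m, truncInv (fun j : Fin m => s (j + 1) ^ 2) n j * (1 / √m * ⟪w (j + 1), g⟫) *
        w (j + 1) l := fun l => by
    simp only [map_smul, PiLp.smul_apply, diagOp_apply, basisOfFin_apply, WithLp.ofLp_sum,
      Finset.sum_apply, WithLp.ofLp_smul, Pi.smul_apply, smul_eq_mul, Finset.mul_sum]
    exact Finset.sum_congr rfl fun j _ => by ring
  simp only [semiAdj, hS, Finset.sum_mul]
  rw [Finset.sum_comm, Finset.mul_sum]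
  refine Finset.sum_congr rfl fun j _ => ?_
  by_cases hj : (j : ℕ) < n + 1
  · have hjn : j ≤ n := Fin.le_def.2 (by omega)
    rw [if_pos hj, approxSingFun, Finset.mul_sum, Finset.mul_sum, Finset.mul_sum]
    refine Finset.sum_congr rfl fun l _ => ?_
    rw [truncInv, if_pos hjn, real_inner_comm]
    ring
  · have hjn : ¬ j ≤ n := fun h => hj (by have := Fin.le_def.1 h; omega)
    rw [if_neg hj]
    simp [truncInv, if_neg hjn]

lemma smul_noisyData (κ : ℝ → ℝ → ℝ) (m : ℕ) (f : L2) (δ : ℝ) (Z : Fin m → ℝ) :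
    (1 / √m : ℝ) • noisyData κ m f δ Z =
      semiDiscrete κ m f + (δ / √m) • WithLp.toLp 2 Z := by
  ext l
  simp only [noisyData, semiDiscrete, PiLp.smul_apply, PiLp.add_apply, smul_eq_mul]
  ring

lemma normSq_eq {h : ℝ → ℝ} {g : L2} (hg : h =ᵐ[unitMeasure] g) : normSq h = ‖g‖ ^ 2 := by
  rw [← real_inner_self_eq_norm_sq, inner_L2, normSq]
  refine integral_congr_ae ?_
  filter_upwards [hg] with y hy
  rw [hy, sq]

lemma KernelBound.estimator_sub_ae_eq (h : KernelBound κ C) (hA : IsMatrixSVD A z w s)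
    (n : Fin m) (f : L2) (δ : ℝ) (Z : Fin m → ℝ) :
    (fun y => estimator κ w s (noisyData κ m f δ Z) (n + 1) y - f y) =ᵐ[unitMeasure]
      (((h.semiOp m).adjoint (diagOp Finset.univ (basisOfFin hA.orthonormal_left)
        (truncInv (fun j : Fin m => s (j + 1) ^ 2) n) (h.semiOp m f)) - f) +
      ∑ j, ⟪basisOfFin hA.orthonormal_left j, WithLp.toLp 2 Z⟫ •
        ((δ / √m * truncInv (fun j : Fin m => s (j + 1) ^ 2) n j) •
          (h.semiOp m).adjoint (basisOfFin hA.orthonormal_left j)) : L2) := by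
  set b := basisOfFin hA.orthonormal_left
  set a := truncInv (fun j : Fin m => s (j + 1) ^ 2) n
  set u := diagOp Finset.univ b a ((1 / √m : ℝ) • noisyData κ m f δ Z) with hu
  have h1 : ((h.semiOp m).adjoint (diagOp Finset.univ b a (h.semiOp m f)) - f) +
      ∑ j, ⟪b j, WithLp.toLp 2 Z⟫ • ((δ / √m * a j) • (h.semiOp m).adjoint (b j)) =
      (h.semiOp m).adjoint u - f := by
    rw [hu, smul_noisyData, map_add, map_add, h.semiOp_apply, sub_add_eq_add_sub]
    congr 2
    rw [diagOp_apply, map_sum]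
    refine Finset.sum_congr rfl fun j _ => ?_
    rw [map_smul, smul_smul, inner_smul_right]
    congr 1
    ring
  rw [h1, h.adjoint_semiOp]
  filter_upwards [coeFn_toL2 (h.taylorBound_semiAdj u).continuousOn,
    Lp.coeFn_sub (toL2 (semiAdj κ m u) (h.taylorBound_semiAdj u).continuousOn) f] with y hy1 hy2
  rw [hy2, Pi.sub_apply, hy1, estimator_eq_semiAdj hA]

end Estimator

/-- Since `‖L† (w j)‖ ^ 2 ≤ mu j + η ≤ 2 * mu j` and `σ (j + 1) ^ 2 ≤ 2 * mu j`, each retained term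
is at most `4 * c ^ 2 / σ (j + 1) ^ 2`, whence the factor `2` in front of the noise level. -/
lemma IsDiscretization.sum_norm_sq_noise_le {H H' E : Type*} [NormedAddCommGroup H]
    [InnerProductSpace ℝ H] [CompleteSpace H] [NormedAddCommGroup H'] [InnerProductSpace ℝ H']
    [NormedAddCommGroup E] [InnerProductSpace ℝ E] [CompleteSpace E] {m : ℕ}
    {K : H →L[ℝ] H'} {L : H →L[ℝ] E} {e : ℕ → H} {σ : ℕ → ℝ}
    {w : OrthonormalBasis (Fin m) ℝ E} {mu : Fin m → ℝ} {η : ℝ}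
    (h : IsDiscretization K L e (fun j => σ (j + 1) ^ 2) w mu η) (n : Fin m)
    (hσ : ∀ j ≤ n, 0 < σ (j + 1) ∧ 10 * η ≤ σ (j + 1) ^ 2) (c : ℝ) :
    ∑ j, ‖(c * truncInv mu n j) • L.adjoint (w j)‖ ^ 2 ≤
      (2 * c) ^ 2 * ∑ j ∈ Finset.Icc 1 ((n : ℕ) + 1), 1 / σ j ^ 2 := by
  have hη := h.eta_nonneg
  rw [← sum_fin_ite_eq (m := m) (by omega), Finset.mul_sum]
  refine Finset.sum_le_sum fun j _ => ?_
  rw [norm_smul, mul_pow, Real.norm_eq_abs, sq_abs]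
  by_cases hj : j ≤ n
  · obtain ⟨hpos, hle⟩ := hσ j hj
    have hmu := h.lam_le j
    have hmu0 : 0 < mu j := by nlinarith
    have hadj : ‖L.adjoint (w j)‖ ^ 2 ≤ mu j + η := by
      refine (h.norm_sq_adjoint_le (w j)).trans (le_of_eq ?_)
      rw [w.norm_eq_one]
      simp [orthonormal_iff_ite.1 w.orthonormal]
    rw [truncInv, if_pos hj, if_pos (by have := Fin.le_def.1 hj; omega)]
    have key : (1 / mu j) ^ 2 * (mu j + η) ≤ 4 * (1 / σ (j + 1) ^ 2) := by
      rw [div_pow, one_pow, mul_one_div, one_div_mul_eq_div, div_le_div_iff₀ (by positivity)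
        (by positivity)]
      have h1 : η ≤ mu j := by linarith
      have h2 : σ (j + 1) ^ 2 ≤ 2 * mu j := by linarith
      calc (mu j + η) * σ (j + 1) ^ 2 ≤ (mu j + mu j) * (2 * mu j) := by gcongr
        _ = 4 * mu j ^ 2 := by ring
    calc (c * (1 / mu j)) ^ 2 * ‖L.adjoint (w j)‖ ^ 2
        ≤ (c * (1 / mu j)) ^ 2 * (mu j + η) := by gcongr
      _ = c ^ 2 * ((1 / mu j) ^ 2 * (mu j + η)) := by ring
      _ ≤ c ^ 2 * (4 * (1 / σ (j + 1) ^ 2)) := by gcongr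
      _ = _ := by ring
  · rw [truncInv, if_neg hj, if_neg fun h' => hj (Fin.le_def.2 (by omega))]
    simp

end SpectralCutoff

/-! ### The risk bound -/

open SpectralCutoff
theorem theoremt4
    (κ : ℝ → ℝ → ℝ) (m : ℕ) (hm : 1 ≤ m)
    (hκ : ContDiffOn ℝ 2 (fun p : ℝ × ℝ => κ p.1 p.2)
      (Set.Icc (0 : ℝ) 1 ×ˢ Set.Icc (0 : ℝ) 1))
    (hrank : Function.Surjective (semiDiscrete κ m))
    (CK : ℝ) (hCK : CK = derivBound κ)
    (σ : ℕ → ℝ) (v : ℕ → L2) (hK : IsSingularSystem κ σ v)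
    (z w : ℕ → EuclideanSpace ℝ (Fin m)) (s : ℕ → ℝ)
    (hA : IsMatrixSVD (quadMatrix κ m) z w s)
    (f : L2)
    (hf : f ∈ (Submodule.span ℝ (Set.range fun j : ℕ => v (j + 1))).topologicalClosure)
    {Ω : Type*} [MeasurableSpace Ω] (P : Measure Ω) [IsProbabilityMeasure P]
    (Z : Fin m → Ω → ℝ) (hZmeas : ∀ l, AEMeasurable (Z l) P)
    (hZL2 : ∀ l, MemLp (Z l) 2 P)
    (hZindep : iIndepFun Z P) (hZident : ∀ l l', IdentDistrib (Z l) (Z l') P P)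
    (hZmean : ∀ l, ∫ ω, Z l ω ∂P = 0) (hZvar : ∀ l, ∫ ω, Z l ω ^ 2 ∂P = 1)
    (δ : ℝ) (hδ : 0 < δ)
    (k : ℕ) (hk1 : 1 ≤ k) (hk : k ≤ maxLevel CK σ m) :
    (k ≤ m ∧ ∀ j, 1 ≤ j → j ≤ k → 0 < s j) ∧
    (∀ ω, MemLp (fun y => estimator κ w s (noisyData κ m f δ fun l => Z l ω) k y - f y)
      2 unitMeasure) ∧
    Integrable (fun ω => normSq fun y =>
      estimator κ w s (noisyData κ m f δ fun l => Z l ω) k y - f y) P ∧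
    Real.sqrt (∫ ω, normSq (fun y =>
        estimator κ w s (noisyData κ m f δ fun l => Z l ω) k y - f y) ∂P) ≤
      2 * δ / Real.sqrt m * Real.sqrt (∑ j ∈ Finset.Icc 1 k, 1 / σ j ^ 2)
      + Real.sqrt (∑' j : ℕ, ⟪f, v (psiPlus σ k + 1 + j)⟫ ^ 2)
      + 2 * (maxMult σ k : ℝ) *
          Real.sqrt (∑ j ∈ Finset.Icc (psiMinus σ k) (psiPlus σ k), ⟪f, v j⟫ ^ 2)
      + (1 + Real.sqrt (2 * (maxMult σ k : ℝ))) * CK ^ 3 * ‖f‖ / (m : ℝ) ^ 2 *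
          Real.sqrt (∑ j ∈ Finset.Icc 1 k, 1 / (gap σ j ^ 2 * σ j ^ 2))
      + Real.sqrt 2 * CK ^ 4 * ‖f‖ / (Real.sqrt 3 * (m : ℝ) ^ 3) *
          ∑ j ∈ Finset.Icc 1 k, 1 / (gap σ j * σ j ^ 2)
      + (maxMult σ k : ℝ) *
          sSup ((fun i : ℕ => 20 * (maxMult σ i : ℝ) * CK ^ 3 * ‖f‖ /
            (gap σ i * σ i * (m : ℝ) ^ 2)) '' Set.Icc 1 (psiPlus σ k)) := by
  have hB : KernelBound κ CK := hCK ▸ kernelBound_derivBound hκ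
  have hD := isDiscretization hB hm hK hA
  have hσ := hB.isSingularSequence hK hD
  have hC := hB.nonneg
  have hm0 : (0 : ℝ) < m := by exact_mod_cast hm
  have hadm : ∀ j, 1 ≤ j → j ≤ k → Admissible CK σ m j := fun j hj hjk =>
    admissible_of_le_maxLevel hk1 hk hj hjk
  have hpos : ∀ j, 1 ≤ j → j ≤ k → 0 < σ j := fun j hj hjk => (hadm j hj hjk).1
  have hgap : ∀ j, 1 ≤ j → j ≤ k → 10 * (CK ^ 2 / m ^ 2) ≤ gap σ j := fun j hj hjk =>
    hσ.ten_mul_le_gap hC hm hj (hadm j hj hjk)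
  have hgappos : ∀ j, 1 ≤ j → j ≤ k → 0 < gap σ j := fun j hj hjk => hσ.gap_pos hj (hpos j hj hjk)
  have hgapsq : ∀ j, 1 ≤ j → j ≤ k → gap σ j ≤ σ j ^ 2 := fun j hj hjk =>
    hσ.gap_le_sq hj (hpos j hj hjk)
  have hη : 0 ≤ CK ^ 2 / (m : ℝ) ^ 2 := hD.eta_nonneg
  -- If `k` exceeded `m`, then `σ k ^ 2 ≤ η` by the dimension count, against `10 * η ≤ gap σ k ≤ σ k
  -- ^ 2`.
  have hkm : k ≤ m := by
    by_contra hlt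
    have h1 := hD.lam_le_of_le (n := k - 1) (by omega)
    simp only [Nat.sub_add_cancel hk1] at h1
    have := hgap k hk1 le_rfl
    have := hgapsq k hk1 le_rfl
    have : 0 < σ k ^ 2 := pow_pos (hpos k hk1 le_rfl) 2
    linarith
  obtain ⟨n, rfl⟩ : ∃ n : Fin m, k = n + 1 := ⟨⟨k - 1, by omega⟩, by simp; omega⟩
  have hspos : ∀ j, 1 ≤ j → j ≤ (n : ℕ) + 1 → 0 < s j := by
    intro j hj hjk
    have h1 := hD.lam_le ⟨j - 1, by omega⟩
    simp only [Nat.sub_add_cancel hj] at h1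
    have := hgap j hj hjk
    have := hgapsq j hj hjk
    have : 0 < σ j ^ 2 := pow_pos (hpos j hj hjk) 2
    exact lt_of_le_of_ne (hA.nonneg j hj (by omega)) fun h0 => by
      rw [← h0] at h1
      norm_num at h1
      linarith
  set b := basisOfFin hA.orthonormal_left
  set a := truncInv (fun j : Fin m => s (j + 1) ^ 2) n
  set L := hB.semiOp m
  set bias := L.adjoint (diagOp Finset.univ b a (L f)) - f
  set d : Fin m → L2 := fun j => (δ / √m * a j) • L.adjoint (b j)
  have hae : ∀ ω, (fun y => estimator κ w s (noisyData κ m f δ fun l => Z l ω) (n + 1) y - f y)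
      =ᵐ[unitMeasure] (bias + ∑ j, ⟪b j, WithLp.toLp 2 fun l => Z l ω⟫ • d j : L2) := fun ω =>
    hB.estimator_sub_ae_eq hA n f δ _
  have hnorm : ∀ ω, normSq (fun y =>
      estimator κ w s (noisyData κ m f δ fun l => Z l ω) (n + 1) y - f y) =
      ‖bias + ∑ j, ⟪b j, WithLp.toLp 2 fun l => Z l ω⟫ • d j‖ ^ 2 := fun ω => normSq_eq (hae ω)
  obtain ⟨hX2, hXmean, hXcov⟩ := whiteNoise_coefficients hZL2 hZindep hZmean hZvar b
  obtain ⟨hint, hval⟩ := integral_norm_sq_add_noise hX2 hXmean hXcov bias d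
  refine ⟨⟨hkm, hspos⟩, fun ω => (memLp_congr_ae (hae ω)).2 (Lp.memLp _), ?_, ?_⟩
  · simpa only [hnorm] using hint
  simp only [hnorm, hval]
  set k := (n : ℕ) + 1 with hkdef
  have hτ := hpos k hk1 le_rfl
  have hψ := psiMinus_mem σ hk1
  have hψk := psiMinus_le σ hk1
  have hkψ := hσ.le_psiPlus hk1 hτ
  have hM := one_le_maxMult σ k
  have hvar : ∑ i, ‖d i‖ ^ 2 ≤ (2 * (δ / √m)) ^ 2 * ∑ j ∈ Finset.Icc 1 k, 1 / σ j ^ 2 :=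
    hD.sum_norm_sq_noise_le n (fun j hj => by
      have hj' := Fin.le_def.1 hj
      exact ⟨hpos _ (by omega) (by omega), (hgap _ (by omega) (by omega)).trans
        (hgapsq _ (by omega) (by omega))⟩) (δ / √m)
  have hbias : ‖bias‖ ≤ √(∑' j, ⟪f, v (psiPlus σ k + j + 1)⟫ ^ 2) +
      √(∑ j ∈ Finset.Ico (psiMinus σ k - 1) (psiPlus σ k), ⟪f, v (j + 1)⟫ ^ 2) +
        6 * (CK ^ 2 / m ^ 2) * CK / (gap σ k * σ k) * ‖f‖ :=
    -- The abstract system starts at index `0`, hence `q = ψ₋(k) - 1`. Indices below `q` exceed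
    -- level `k` by at least the gap, and those in `[q, p)` form the block of `σ k`.
    hD.norm_bias_le (n := n) (q := psiMinus σ k - 1) (p := psiPlus σ k) (by omega)
      (hB.norm_semiDiscrete_le m) hτ (hσ.le_bound hC hk1) rfl (hgappos k hk1 le_rfl)
      (hgapsq k hk1 le_rfl) (hgap k hk1 le_rfl)
      (fun i hi => hσ.add_gap_le hk1 (by omega) (by omega)) hf
  have htail : ∑' j, ⟪f, v (psiPlus σ k + j + 1)⟫ ^ 2 =
      ∑' j : ℕ, ⟪f, v (psiPlus σ k + 1 + j)⟫ ^ 2 :=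
    tsum_congr fun j => by rw [add_right_comm]
  have hblock : ∑ j ∈ Finset.Ico (psiMinus σ k - 1) (psiPlus σ k), ⟪f, v (j + 1)⟫ ^ 2 =
      ∑ j ∈ Finset.Icc (psiMinus σ k) (psiPlus σ k), ⟪f, v j⟫ ^ 2 := by
    rw [Finset.sum_Ico_add' (fun j => ⟪f, v j⟫ ^ 2) _ _ 1, Nat.sub_add_cancel hψ.1,
      Finset.Ico_add_one_right_eq_Icc]
  rw [htail, hblock] at hbias
  have hsup : 20 * (maxMult σ k : ℝ) * CK ^ 3 * ‖f‖ / (gap σ k * σ k * (m : ℝ) ^ 2) ≤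
      sSup ((fun i : ℕ => 20 * (maxMult σ i : ℝ) * CK ^ 3 * ‖f‖ /
        (gap σ i * σ i * (m : ℝ) ^ 2)) '' Set.Icc 1 (psiPlus σ k)) :=
    le_csSup ((Set.finite_Icc _ _).image _).bddAbove ⟨k, ⟨hk1, hkψ⟩, rfl⟩
  have hg0 := hgappos k hk1 le_rfl
  -- The maximum in the last term is bounded below by its entry at `i = k`; the constant `6` fits
  -- under `20 * maxMult σ k ^ 2`.
  have hlast : 6 * (CK ^ 2 / m ^ 2) * CK / (gap σ k * σ k) * ‖f‖ ≤ (maxMult σ k : ℝ) *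
      sSup ((fun i : ℕ => 20 * (maxMult σ i : ℝ) * CK ^ 3 * ‖f‖ /
        (gap σ i * σ i * (m : ℝ) ^ 2)) '' Set.Icc 1 (psiPlus σ k)) := by
    refine le_trans ?_ (mul_le_mul_of_nonneg_left hsup (by positivity))
    calc 6 * (CK ^ 2 / m ^ 2) * CK / (gap σ k * σ k) * ‖f‖
        = 6 * (1 * 1) * (CK ^ 3 * ‖f‖ / (gap σ k * σ k * (m : ℝ) ^ 2)) := by field_simp
      _ ≤ 20 * (maxMult σ k * maxMult σ k) *
          (CK ^ 3 * ‖f‖ / (gap σ k * σ k * (m : ℝ) ^ 2)) := by gcongr; norm_num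
      _ = _ := by ring
  have hblock_le : √(∑ j ∈ Finset.Icc (psiMinus σ k) (psiPlus σ k), ⟪f, v j⟫ ^ 2) ≤
      2 * (maxMult σ k : ℝ) *
        √(∑ j ∈ Finset.Icc (psiMinus σ k) (psiPlus σ k), ⟪f, v j⟫ ^ 2) :=
    le_mul_of_one_le_left (Real.sqrt_nonneg _) (by linarith)
  have hfourth : 0 ≤ (1 + √(2 * (maxMult σ k : ℝ))) * CK ^ 3 * ‖f‖ / (m : ℝ) ^ 2 *
      √(∑ j ∈ Finset.Icc 1 k, 1 / (gap σ j ^ 2 * σ j ^ 2)) := by positivity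
  have hfifth : 0 ≤ √2 * CK ^ 4 * ‖f‖ / (√3 * (m : ℝ) ^ 3) *
      ∑ j ∈ Finset.Icc 1 k, 1 / (gap σ j * σ j ^ 2) := by
    refine mul_nonneg (by positivity) (Finset.sum_nonneg fun j hj => ?_)
    obtain ⟨h1, h2⟩ := Finset.mem_Icc.1 hj
    have := hgappos j h1 h2
    positivity
  -- Bias and noise are orthogonal in mean square, and `√(a ^ 2 + b ^ 2) ≤ a + b` for nonnegative
  -- `a`, `b` separates them.
  have hsqrt : √(‖bias‖ ^ 2 + ∑ i, ‖d i‖ ^ 2) ≤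
      ‖bias‖ + 2 * δ / √m * √(∑ j ∈ Finset.Icc 1 k, 1 / σ j ^ 2) := by
    have hS : 0 ≤ ∑ j ∈ Finset.Icc 1 k, 1 / σ j ^ 2 := Finset.sum_nonneg fun _ _ => by positivity
    have hr : 0 ≤ 2 * δ / √m * √(∑ j ∈ Finset.Icc 1 k, 1 / σ j ^ 2) := by positivity
    rw [Real.sqrt_le_left (by positivity)]
    have hr2 : (2 * δ / √m * √(∑ j ∈ Finset.Icc 1 k, 1 / σ j ^ 2)) ^ 2 =
        (2 * (δ / √m)) ^ 2 * ∑ j ∈ Finset.Icc 1 k, 1 / σ j ^ 2 := by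
      rw [mul_pow, Real.sq_sqrt hS, mul_div_assoc]
    nlinarith [mul_nonneg (norm_nonneg bias) hr]
  linarith
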